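/- Let $n\ge 0$ and $L>0$. Let $P$ be a probability measure on a measurable space $\Xi$ and let $F:\mathbb R^n\times\Xi\to\mathbb R$ be measurable with $F(x,\cdot)\in L^1(P)$ for every $x$, and such that for $P$-almost every $s$ the function $F(\cdot,s)$ belongs to $\mathcal C^{1,1}_L(\mathbb R^n)$, i.e. it is differentiable and its gradient is Lipschitz continuous with constant $L$. Let $f(x)=\int_\Xi F(x,s)\,dP(s)$ be bounded below, and put $f^*=\inf_{x\in\mathbb R^n}f(x)$ and $G(x,s)=\nabla_xF(x,s)$. The randomized stochastic gradient free (RSGF) method takes an initial point $x_1\in\mathbb R^n$, an iteration limit $N\ge 1$, a smoothing parameter $\mu>0$ and stepsizes $\gamma_1,\dots,\gamma_N>0$. It sets, for $k=1,\dots,N$, $$x_{k+1}=x_k-\gamma_k\,G_\mu(x_k,\xi_k,u_k),\qquad G_\mu(x,\xi,u)=\frac{F(x+\mu u,\xi)-F(x,\xi)}{\mu}\,u ,$$ and outputs $x_R$. Here $\xi_1,\dots,\xi_N$ are $\Xi$-valued random variables with $F(\cdot,\xi_k)\in\mathcal C^{1,1}_L(\mathbb R^n)$ almost surely; each $u_k$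 is a standard Gaussian vector in $\mathbb R^n$ independent of $(\xi_1,u_1,\dots,\xi_{k-1},u_{k-1},\xi_k)$; and $R$ is a random index in $\{1,\dots,N\}$ independent of $(\xi_k,u_k)_{1\le k\le N}$. The $\xi_k$ need not be independent of each other nor of the search points. Let $\mathcal H_{k-1}$ be the $\sigma$-algebra generated by $(\xi_j,u_j)$, $1\le j<k$, let $\sigma\ge 0$, and assume for $k=1,\dots,N$: * (A1) $G(x_k,\xi_k)$ is integrable, $\mathbb E[G(x_k,\xi_k)\mid\mathcal H_{k-1}]=\nabla f(x_k)$ almost surely, and $\mathbb E\big[\|G(x_k,\xi_k)-\nabla f(x_k)\|^2\big]\le\sigma^2$; * (A3) for each of the two points $y\in\{x_k,\;x_k+\mu u_k\}$ at which function values are requested at step $k$, $F(y,\xi_k)$ is integrable and $\mathbb E[F(y,\xi_k)\mid\mathcal H_{k-1},u_k]=f(y)$ almost surely. Suppose that $\gamma_k<\dfrac{1}{2(n+4)L}$ for $k=1,\dots,N$ and $$\mathrm{Prob}\{R=k\}=\frac{\gamma_k-2L(n+4)\gamma_k^2}{\sum_{j=1}^N[\gamma_j-2L(n+4)\gamma_j^2]},\qquad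 k=1,\dots,N.$$ (a) With $D_f=\left[\dfrac{2(f(x_1)-f^*)}{L}\right]^{1/2}$, the random variable $\|\nabla f(x_R)\|^2$ is integrable and $$\frac1L\,\mathbb E\big[\|\nabla f(x_R)\|^2\big]\le\frac{D_f^2+2\mu^2(n+4)\Big(1+L(n+4)^2\sum_{k=1}^N\big(\tfrac{\gamma_k}{4}+L\gamma_k^2\big)\Big)+2(n+4)\sigma^2\sum_{k=1}^N\gamma_k^2}{\sum_{k=1}^N[\gamma_k-2L(n+4)\gamma_k^2]} .$$ (b) If, in addition, $f$ is convex and $x^*$ is a minimizer of $f$, then with $D_X=\|x_1-x^*\|$ the random variable $f(x_R)-f^*$ is integrable and $$\mathbb E[f(x_R)-f^*]\le\frac{D_X^2+2\mu^2L(n+4)\sum_{k=1}^N\big[\gamma_k+L(n+4)^2\gamma_k^2\big]+2(n+4)\sigma^2\sum_{k=1}^N\gamma_k^2}{2\sum_{k=1}^N[\gamma_k-2(n+4)L\gamma_k^2]} .$$ -/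

import Mathlib

open MeasureTheory ProbabilityTheory
open scoped Gradient

/-- The class of differentiable functions on `ℝⁿ` whose gradient is Lipschitz with constant `L`. -/
def IsC11 {n : ℕ} (L : ℝ) (g : EuclideanSpace ℝ (Fin n) → ℝ) : Prop :=
  Differentiable ℝ g ∧ ∀ x y, ‖∇ g y - ∇ g x‖ ≤ L * ‖y - x‖

/-- The objective function `f(x) = ∫ F(x, ξ) dP(ξ)`. -/
noncomputable def objective {n : ℕ} {Ξ : Type*} [MeasurableSpace Ξ]
    (F : EuclideanSpace ℝ (Fin n) → Ξ → ℝ) (P : Measure Ξ) (x : EuclideanSpace ℝ (Fin n)) : ℝ :=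
  ∫ s, F x s ∂P

/-- The stochastic gradient `G(x, s) = ∇ₓ F(x, s)`. -/
noncomputable def stochGrad {n : ℕ} {Ξ : Type*}
    (F : EuclideanSpace ℝ (Fin n) → Ξ → ℝ) (x : EuclideanSpace ℝ (Fin n)) (s : Ξ) :
    EuclideanSpace ℝ (Fin n) :=
  ∇ (fun y => F y s) x

/-- The Gaussian-smoothing estimator `G_μ(x, s, v) = ((F(x + μ v, s) - F(x, s)) / μ) v`. -/
noncomputable def zerothGrad {n : ℕ} {Ξ : Type*}
    (F : EuclideanSpace ℝ (Fin n) → Ξ → ℝ) (μ : ℝ)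
    (x : EuclideanSpace ℝ (Fin n)) (s : Ξ) (v : EuclideanSpace ℝ (Fin n)) :
    EuclideanSpace ℝ (Fin n) :=
  ((F (x + μ • v) s - F x s) / μ) • v

/-- The search points `x₁, x₂, …` of the method, indexed from `1` (the value at index `0` is
never used): `x_{k+1} = x_k - γ_k G_μ(x_k, ξ_k, u_k)` for `k ≥ 1`. -/
noncomputable def searchPoint {n : ℕ} {Ξ Ω : Type*}
    (F : EuclideanSpace ℝ (Fin n) → Ξ → ℝ) (μ : ℝ) (γ : ℕ → ℝ) (x₁ : EuclideanSpace ℝ (Fin n))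
    (ξ : ℕ → Ω → Ξ) (u : ℕ → Ω → EuclideanSpace ℝ (Fin n)) :
    ℕ → Ω → EuclideanSpace ℝ (Fin n)
  | 0, _ => x₁
  | 1, _ => x₁
  | k + 2, ω =>
      searchPoint F μ γ x₁ ξ u (k + 1) ω
        - γ (k + 1) • zerothGrad F μ (searchPoint F μ γ x₁ ξ u (k + 1) ω) (ξ (k + 1) ω)
            (u (k + 1) ω)

/-- The `σ`-algebra generated by `(ξ_j, u_j)`, `1 ≤ j < k`: what is known before step `k`. -/
@[reducible] def past {n : ℕ} {Ξ Ω : Type*} [MeasurableSpace Ξ]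
    (ξ : ℕ → Ω → Ξ) (u : ℕ → Ω → EuclideanSpace ℝ (Fin n)) (k : ℕ) : MeasurableSpace Ω :=
  ⨆ j ∈ Finset.Ico 1 k,
    (MeasurableSpace.comap (ξ j) inferInstance ⊔ MeasurableSpace.comap (u j) inferInstance)

/-- At step `k` with search point `X`: the stochastic gradient is, conditionally on the past, an
unbiased estimator of `∇ f` at `X`, and its mean squared error is at most `σ²`. -/
def UnbiasedGradient {n : ℕ} {Ξ Ω : Type*} [MeasurableSpace Ξ] [MeasurableSpace Ω]
    (Pr : Measure Ω) (F : EuclideanSpace ℝ (Fin n) → Ξ → ℝ) (f : EuclideanSpace ℝ (Fin n) → ℝ)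
    (σ : ℝ) (ξ : ℕ → Ω → Ξ) (u : ℕ → Ω → EuclideanSpace ℝ (Fin n))
    (k : ℕ) (X : Ω → EuclideanSpace ℝ (Fin n)) : Prop :=
  Integrable (fun ω => stochGrad F (X ω) (ξ k ω)) Pr ∧
  Pr[fun ω => stochGrad F (X ω) (ξ k ω) | past ξ u k] =ᵐ[Pr] (fun ω => ∇ f (X ω)) ∧
  ∫⁻ ω, ‖stochGrad F (X ω) (ξ k ω) - ∇ f (X ω)‖ₑ ^ 2 ∂Pr ≤ ENNReal.ofReal (σ ^ 2)

/-- At step `k`, the oracle called at the (random) point `Y` returns an unbiased function value,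
conditionally on the past and on the direction `u_k` (the data that determine the points at which
the oracle is called at step `k`). -/
def UnbiasedValue {n : ℕ} {Ξ Ω : Type*} [MeasurableSpace Ξ] [MeasurableSpace Ω]
    (Pr : Measure Ω) (F : EuclideanSpace ℝ (Fin n) → Ξ → ℝ) (f : EuclideanSpace ℝ (Fin n) → ℝ)
    (ξ : ℕ → Ω → Ξ) (u : ℕ → Ω → EuclideanSpace ℝ (Fin n))
    (k : ℕ) (Y : Ω → EuclideanSpace ℝ (Fin n)) : Prop :=
  Integrable (fun ω => F (Y ω) (ξ k ω)) Pr ∧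
  Pr[fun ω => F (Y ω) (ξ k ω) | past ξ u k ⊔ MeasurableSpace.comap (u k) inferInstance]
    =ᵐ[Pr] (fun ω => f (Y ω))

/-- The unnormalized weight `γ_k - 2 L (n + 4) γ_k²`. -/
def weight (n : ℕ) (L : ℝ) (γ : ℕ → ℝ) (k : ℕ) : ℝ :=
  γ k - 2 * L * (n + 4) * γ k ^ 2

/-! Both bounds come from one-step inequalities for `f` itself; no smoothed objective is minimized.
Write G for the stochastic gradient, g for ∇f(x_k) and u for the direction. The quadratic bound for
F(·, ξ) puts the estimator W within (μL/2)‖u‖³ of ⟪G, u⟫u. As u is independent of the past and of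
ξ_k, it can be integrated out first. Stein's identity gives E⟪g, u⟫⟪G, u⟫ = E⟪g, G⟫, E⟪G, u⟫²‖u‖² =
(n+2) E‖G‖² and E‖u‖⁶ = n(n+2)(n+4). Unbiasedness and the variance bound then yield E‖W‖² ≤
2(n+2)(E‖g‖² + σ²) + O(μ²) and E⟪g, W⟫ ≥ ½E‖g‖² - O(μ²) (`zerothGrad_moments`).

For (a), these two estimates enter the descent inequality for f, which is C^{1,1} by
`isC11_objective`. The part of E‖W‖² proportional to E‖g‖² turns the coefficient γ into the weight,
and summation telescopes.

For (b), expand ‖x_{k+1} - x*‖². Comparing W with ⟪G, u⟫u would leave an error multiplied by the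
uncontrolled distance ‖x_k - x*‖. Conditioning on the past and on u instead replaces F by f exactly
in the difference quotient. Stein's identity turns that quotient into an average of ∇f(x_k + μu),
and convexity is applied between x_k + μu and x* + μu (`inner_zerothGrad_ge_of_convexOn`). The
second moment is absorbed through ‖∇f‖² ≤ 2L(f - f*).

In both cases the law of R makes the expectation at x_R the weighted average of the summed
quantities. -/

section Gaussian

/-! ### Stein's identity and moments of the standard Gaussian. -/

open scoped RealInnerProductSpace
open Module (finrank)

variable {E : Type*} [NormedAddCommGroup E] [InnerProductSpace ℝ E]

/-- The Lebesgue density of the standard Gaussian measure. -/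
noncomputable def gaussianDensity (E : Type*) [NormedAddCommGroup E] [InnerProductSpace ℝ E]
    (x : E) : ℝ :=
  ((2 * Real.pi) ^ (finrank ℝ E / 2 : ℝ))⁻¹ * Real.exp (-(1 / 2) * ‖x‖ ^ 2)

lemma gaussianDensity_nonneg (x : E) : 0 ≤ gaussianDensity E x := by
  unfold gaussianDensity; positivity

lemma continuous_gaussianDensity : Continuous (gaussianDensity E) := by
  unfold gaussianDensity; fun_prop

lemma hasFDerivAt_gaussianDensity (x : E) :
    HasFDerivAt (gaussianDensity E) (-(gaussianDensity E x) • innerSL ℝ x) x := by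
  unfold gaussianDensity
  have h := ((((hasStrictFDerivAt_norm_sq x).hasFDerivAt).const_mul (-(1 / 2) : ℝ)).exp).const_mul
    (((2 * Real.pi) ^ (finrank ℝ E / 2 : ℝ))⁻¹)
  refine h.congr_fderiv ?_
  ext y
  simp
  ring

lemma hasFDerivAt_inner_left (a x : E) :
    HasFDerivAt (fun x : E => (inner ℝ a x : ℝ)) (innerSL ℝ a) x :=
  (innerSL ℝ a).hasFDerivAt

variable [FiniteDimensional ℝ E] [MeasurableSpace E] [BorelSpace E]

lemma integrable_gaussianDensity : Integrable (gaussianDensity E) := by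
  have h := (GaussianFourier.integrable_cexp_neg_mul_sq_norm_add (V := E) (b := 1 / 2)
    (by norm_num) 0 0).re.const_mul (((2 * Real.pi) ^ (finrank ℝ E / 2 : ℝ))⁻¹)
  refine h.congr (ae_of_all _ fun x => ?_)
  have : Complex.exp (-(1 / 2 : ℂ) * ↑‖x‖ ^ 2 + 0 * ((inner ℝ (0 : E) x : ℝ) : ℂ))
      = ((Real.exp (-(1 / 2) * ‖x‖ ^ 2) : ℝ) : ℂ) := by
    push_cast; simp
  simp only [gaussianDensity, this, RCLike.re_eq_complex_re, Complex.ofReal_re]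

lemma integral_gaussianDensity : ∫ x, gaussianDensity E x = 1 := by
  unfold gaussianDensity
  rw [integral_const_mul, GaussianFourier.integral_rexp_neg_mul_sq_norm (by norm_num)]
  rw [show Real.pi / (1 / 2) = 2 * Real.pi by ring]
  exact inv_mul_cancel₀ (by positivity)

/-- Both sides have the same characteristic function. The density makes integration by parts against
Lebesgue measure available. -/
lemma stdGaussian_eq_withDensity :
    stdGaussian E = volume.withDensity (fun x => ENNReal.ofReal (gaussianDensity E x)) := by
  have : IsProbabilityMeasure
      ((volume : Measure E).withDensity (fun x => ENNReal.ofReal (gaussianDensity E x))) := by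
    refine ⟨?_⟩
    rw [withDensity_apply _ MeasurableSet.univ, Measure.restrict_univ,
      ← ofReal_integral_eq_lintegral_ofReal integrable_gaussianDensity
        (ae_of_all _ gaussianDensity_nonneg), integral_gaussianDensity, ENNReal.ofReal_one]
  refine Measure.ext_of_charFun (funext fun t => ?_)
  rw [charFun_stdGaussian, charFun_apply,
    integral_withDensity_eq_integral_toReal_smul (by
      exact (continuous_gaussianDensity.measurable).ennreal_ofReal)
      (ae_of_all _ fun _ => ENNReal.ofReal_lt_top)]
  have h := GaussianFourier.integral_cexp_neg_mul_sq_norm_add (V := E) (b := 1 / 2)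
    (by norm_num) Complex.I t
  have h2 : ∀ x : E, (ENNReal.ofReal (gaussianDensity E x)).toReal •
      Complex.exp (((inner ℝ x t : ℝ) : ℂ) * Complex.I) =
      ((((2 * Real.pi) ^ (finrank ℝ E / 2 : ℝ))⁻¹ : ℝ) : ℂ) *
      Complex.exp (-(1 / 2 : ℂ) * ↑‖x‖ ^ 2 + Complex.I * ((inner ℝ t x : ℝ) : ℂ)) := by
    intro x
    rw [ENNReal.toReal_ofReal (gaussianDensity_nonneg x), gaussianDensity, Complex.exp_add,
      real_inner_comm, Complex.real_smul]
    push_cast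
    ring_nf
  simp_rw [h2]
  rw [integral_const_mul, h, show (Real.pi : ℂ) / (1 / 2) = ((2 * Real.pi : ℝ) : ℂ) by
    push_cast; ring]
  rw [show (finrank ℝ E : ℂ) / 2 = ((finrank ℝ E / 2 : ℝ) : ℂ) by push_cast; rfl,
    ← Complex.ofReal_cpow (by positivity), ← mul_assoc, ← Complex.ofReal_mul,
    inv_mul_cancel₀ (by positivity), Complex.ofReal_one, one_mul, Complex.I_sq]
  congr 1
  ring

lemma integrable_stdGaussian_iff {h : E → ℝ} :
    Integrable h (stdGaussian E) ↔ Integrable (fun x => h x * gaussianDensity E x) := by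
  rw [stdGaussian_eq_withDensity, integrable_withDensity_iff
    continuous_gaussianDensity.measurable.ennreal_ofReal (ae_of_all _ fun _ => ENNReal.ofReal_lt_top)]
  simp_rw [ENNReal.toReal_ofReal (gaussianDensity_nonneg _)]

lemma integral_stdGaussian (h : E → ℝ) :
    ∫ x, h x ∂(stdGaussian E) = ∫ x, h x * gaussianDensity E x := by
  rw [stdGaussian_eq_withDensity, integral_withDensity_eq_integral_toReal_smul
    continuous_gaussianDensity.measurable.ennreal_ofReal (ae_of_all _ fun _ => ENNReal.ofReal_lt_top)]
  simp_rw [ENNReal.toReal_ofReal (gaussianDensity_nonneg _), smul_eq_mul, mul_comm]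

/-- Stein's identity. -/
theorem integral_mul_inner_stdGaussian {h : E → ℝ} (hh : Differentiable ℝ h) (d : E)
    (h_int : Integrable h (stdGaussian E))
    (h_inner : Integrable (fun x => h x * inner ℝ x d) (stdGaussian E))
    (h_deriv : Integrable (fun x => fderiv ℝ h x d) (stdGaussian E)) :
    ∫ x, h x * inner ℝ x d ∂(stdGaussian E) = ∫ x, fderiv ℝ h x d ∂(stdGaussian E) := by
  have hd : ∀ x, fderiv ℝ (gaussianDensity E) x d = -(inner ℝ x d * gaussianDensity E x) := by
    intro x
    rw [(hasFDerivAt_gaussianDensity x).fderiv]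
    simp [mul_comm]
  rw [integrable_stdGaussian_iff] at h_int h_inner h_deriv
  -- Integration by parts: the derivative of the density along d is -⟪x, d⟫ times the density.
  have := integral_mul_fderiv_eq_neg_fderiv_mul_of_integrable (μ := (volume : Measure E))
    (f := h) (g := gaussianDensity E) (v := d) h_deriv
    (by
      refine h_inner.neg.congr (ae_of_all _ fun x => ?_)
      simp only [hd, Pi.neg_apply]; ring) h_int
    (fun x _ => hh x) (fun x _ => (hasFDerivAt_gaussianDensity x).differentiableAt)
  rw [integral_stdGaussian, integral_stdGaussian]
  rw [← neg_inj, ← this, ← integral_neg]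
  congr 1
  ext x
  rw [hd]; ring

lemma integrable_norm_pow_stdGaussian (k : ℕ) :
    Integrable (fun x : E => ‖x‖ ^ k) (stdGaussian E) := by
  rcases Nat.eq_zero_or_pos k with rfl | hk
  · simp
  · exact (IsGaussian.memLp_id (stdGaussian E) (k : ENNReal) (by simp)).integrable_norm_pow hk.ne'

lemma integrable_stdGaussian_of_norm_le {h : E → ℝ} (hh : Continuous h) (C : ℝ) (k : ℕ)
    (hb : ∀ x, |h x| ≤ C * ‖x‖ ^ k) : Integrable h (stdGaussian E) :=
  ((integrable_norm_pow_stdGaussian k).const_mul C).mono' hh.aestronglyMeasurable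
    (ae_of_all _ hb)

/-- Stein's identity for ‖x‖^{2m}⟪x, b i⟫ in the direction b i, summed over an orthonormal basis:
the derivatives add up to (dim + 2m)‖x‖^{2m}. -/
lemma integral_norm_pow_stdGaussian_succ (m : ℕ) :
    ∫ x : E, (‖x‖ ^ 2) ^ (m + 1) ∂(stdGaussian E)
      = (finrank ℝ E + 2 * m) * ∫ x : E, (‖x‖ ^ 2) ^ m ∂(stdGaussian E) := by
  let b := stdOrthonormalBasis ℝ E
  have hder : ∀ i (x : E), HasFDerivAt (fun x : E => (‖x‖ ^ 2) ^ m * inner ℝ x (b i))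
      ((‖x‖ ^ 2) ^ m • innerSL ℝ (b i) +
        (inner ℝ x (b i)) • ((m * (‖x‖ ^ 2) ^ (m - 1) : ℝ) • ((2 : ℝ) • innerSL ℝ x))) x := by
    intro i x
    have h1 : HasFDerivAt (fun x : E => (‖x‖ ^ 2) ^ m)
        ((m * (‖x‖ ^ 2) ^ (m - 1) : ℝ) • ((2 : ℝ) • innerSL ℝ x)) x := by
      have := ((hasStrictFDerivAt_norm_sq x).hasFDerivAt).pow m
      refine this.congr_fderiv ?_
      ext y; simp [nsmul_eq_mul]
    have h2 : HasFDerivAt (fun x : E => inner ℝ x (b i)) (innerSL ℝ (b i)) x := by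
      have := (innerSL ℝ (b i)).hasFDerivAt (x := x)
      refine this.congr_of_eventuallyEq (Filter.Eventually.of_forall fun y => ?_)
      simp [real_inner_comm]
    exact h1.mul h2
  have hval : ∀ i (x : E), fderiv ℝ (fun x : E => (‖x‖ ^ 2) ^ m * inner ℝ x (b i)) x (b i)
      = (‖x‖ ^ 2) ^ m + 2 * m * ((‖x‖ ^ 2) ^ (m - 1) * inner ℝ x (b i) ^ 2) := by
    intro i x
    rw [(hder i x).fderiv]
    simp [b.norm_eq_one]
    ring
  have hin : ∀ i (x : E), |inner ℝ x (b i)| ≤ ‖x‖ := by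
    intro i x
    simpa [b.norm_eq_one] using abs_real_inner_le_norm x (b i)
  have hsum : ∀ x : E, ∑ i, inner ℝ x (b i) ^ 2 = ‖x‖ ^ 2 := fun x => by
    simpa using b.sum_sq_inner_left x
  have i1 : ∀ i, Integrable (fun x : E => (‖x‖ ^ 2) ^ m * inner ℝ x (b i)) (stdGaussian E) := by
    intro i
    refine integrable_stdGaussian_of_norm_le (by fun_prop) 1 (2 * m + 1) fun x => ?_
    rw [abs_mul, abs_of_nonneg (by positivity), one_mul,
      pow_succ ‖x‖ (2 * m), pow_mul]
    gcongr; exact hin i x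
  have i2 : ∀ i, Integrable (fun x : E => (‖x‖ ^ 2) ^ m * inner ℝ x (b i) * inner ℝ x (b i))
      (stdGaussian E) := by
    intro i
    refine integrable_stdGaussian_of_norm_le (by fun_prop) 1 (2 * m + 2) fun x => ?_
    rw [abs_mul, abs_mul, abs_of_nonneg (by positivity : 0 ≤ (‖x‖ ^ 2) ^ m), one_mul,
      pow_succ ‖x‖ (2 * m + 1), pow_succ ‖x‖ (2 * m), pow_mul]
    gcongr <;> exact hin i x
  have i0 : Integrable (fun x : E => (‖x‖ ^ 2) ^ m) (stdGaussian E) := by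
    simpa [← pow_mul] using integrable_norm_pow_stdGaussian (E := E) (2 * m)
  have i3 : ∀ i, Integrable (fun x : E => (‖x‖ ^ 2) ^ (m - 1) * inner ℝ x (b i) ^ 2)
      (stdGaussian E) := by
    intro i
    refine integrable_stdGaussian_of_norm_le (by fun_prop) 1 (2 * (m - 1) + 2) fun x => ?_
    rw [abs_mul, abs_of_nonneg (by positivity : 0 ≤ (‖x‖ ^ 2) ^ (m - 1)), one_mul, pow_add,
      pow_mul, abs_pow]
    gcongr; exact hin i x
  have stein : ∀ i, ∫ x, (‖x‖ ^ 2) ^ m * inner ℝ x (b i) * inner ℝ x (b i) ∂(stdGaussian E)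
      = ∫ x : E, ((‖x‖ ^ 2) ^ m + 2 * m * ((‖x‖ ^ 2) ^ (m - 1) * inner ℝ x (b i) ^ 2))
          ∂(stdGaussian E) := by
    intro i
    have := integral_mul_inner_stdGaussian (h := fun x : E => (‖x‖ ^ 2) ^ m * inner ℝ x (b i))
      (fun x => (hder i x).differentiableAt) (b i) (i1 i) (i2 i)
      (by simp_rw [hval]; exact i0.add ((i3 i).const_mul _))
    simp_rw [hval] at this
    exact this
  have e1 : ∀ x : E, (‖x‖ ^ 2) ^ (m + 1)
      = ∑ i, (‖x‖ ^ 2) ^ m * inner ℝ x (b i) * inner ℝ x (b i) := by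
    intro x
    rw [pow_succ]; nth_rw 2 [← hsum x]
    rw [Finset.mul_sum]
    exact Finset.sum_congr rfl fun i _ => by ring
  simp_rw [e1]
  rw [integral_finsetSum _ fun i _ => i2 i]
  simp_rw [stein]
  rw [← integral_finsetSum (f := fun i (x : E) => (‖x‖ ^ 2) ^ m +
    2 * m * ((‖x‖ ^ 2) ^ (m - 1) * inner ℝ x (b i) ^ 2)) _
    fun i _ => i0.add ((i3 i).const_mul _)]
  rw [← integral_const_mul]
  congr 1
  ext x
  rw [Finset.sum_add_distrib, ← Finset.mul_sum, ← Finset.mul_sum, hsum]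
  -- For m = 0 the exponent m - 1 is truncated, but its term carries the factor m.
  rcases Nat.eq_zero_or_pos m with rfl | hm
  · simp
  · have : (‖x‖ ^ 2) ^ (m - 1) * ‖x‖ ^ 2 = (‖x‖ ^ 2) ^ m := by
      rw [← pow_succ, Nat.sub_add_cancel hm]
    rw [this]; simp; ring

lemma integral_norm_pow_two_stdGaussian :
    ∫ x : E, ‖x‖ ^ 2 ∂(stdGaussian E) = finrank ℝ E := by
  have := integral_norm_pow_stdGaussian_succ (E := E) 0
  simpa using this

lemma integral_norm_pow_four_stdGaussian :
    ∫ x : E, ‖x‖ ^ 4 ∂(stdGaussian E) = finrank ℝ E * (finrank ℝ E + 2) := by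
  have := integral_norm_pow_stdGaussian_succ (E := E) 1
  simp only [← pow_mul, integral_norm_pow_two_stdGaussian] at this
  norm_num at this
  rw [this]; ring

lemma integral_norm_pow_six_stdGaussian :
    ∫ x : E, ‖x‖ ^ 6 ∂(stdGaussian E)
      = finrank ℝ E * (finrank ℝ E + 2) * (finrank ℝ E + 4) := by
  have := integral_norm_pow_stdGaussian_succ (E := E) 2
  simp only [← pow_mul] at this
  norm_num [integral_norm_pow_four_stdGaussian] at this
  rw [this]; ring

lemma integral_inner_mul_inner_stdGaussian (a b : E) :
    ∫ x, inner ℝ a x * inner ℝ b x ∂(stdGaussian E) = inner ℝ a b := by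
  have hin : ∀ c x : E, |(inner ℝ c x : ℝ)| ≤ ‖c‖ * ‖x‖ := fun c x => abs_real_inner_le_norm c x
  have := integral_mul_inner_stdGaussian (h := fun x : E => (inner ℝ a x : ℝ))
    (fun x => (hasFDerivAt_inner_left a x).differentiableAt) b
    (integrable_stdGaussian_of_norm_le (by fun_prop) ‖a‖ 1 fun x => by simpa using hin a x)
    (integrable_stdGaussian_of_norm_le (by fun_prop) (‖a‖ * ‖b‖) 2 fun x => by
      rw [abs_mul, real_inner_comm b]
      calc _ ≤ (‖a‖ * ‖x‖) * (‖b‖ * ‖x‖) := by gcongr <;> apply hin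
        _ = _ := by ring)
    (by simp_rw [(hasFDerivAt_inner_left a _).fderiv]; exact integrable_const _)
  simp_rw [(hasFDerivAt_inner_left a _).fderiv] at this
  simp_rw [real_inner_comm b] at this
  simpa using this

/-- Stein's identity for ⟪a, x⟫‖x‖² in the direction a; the derivative 2⟪a, x⟫² + ‖a‖²‖x‖² has known
moments. -/
lemma integral_inner_sq_mul_norm_sq_stdGaussian (a : E) :
    ∫ x, inner ℝ a x ^ 2 * ‖x‖ ^ 2 ∂(stdGaussian E) = (finrank ℝ E + 2) * ‖a‖ ^ 2 := by
  have hin : ∀ x : E, |(inner ℝ a x : ℝ)| ≤ ‖a‖ * ‖x‖ := fun x => abs_real_inner_le_norm a x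
  have hder : ∀ x : E, HasFDerivAt (fun x : E => (inner ℝ a x : ℝ) * ‖x‖ ^ 2)
      ((inner ℝ a x : ℝ) • ((2 : ℝ) • innerSL ℝ x) + (‖x‖ ^ 2) • innerSL ℝ a) x := by
    intro x
    refine ((hasFDerivAt_inner_left a x).mul (hasStrictFDerivAt_norm_sq x).hasFDerivAt).congr_fderiv ?_
    ext y; simp
  have hval : ∀ x : E, fderiv ℝ (fun x : E => (inner ℝ a x : ℝ) * ‖x‖ ^ 2) x a
      = 2 * (inner ℝ a x * inner ℝ a x) + ‖a‖ ^ 2 * ‖x‖ ^ 2 := by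
    intro x
    rw [(hder x).fderiv]
    simp [real_inner_comm a x]
    ring
  have i1 : Integrable (fun x : E => (inner ℝ a x : ℝ) * inner ℝ a x) (stdGaussian E) :=
    integrable_stdGaussian_of_norm_le (by fun_prop) (‖a‖ * ‖a‖) 2 fun x => by
      rw [abs_mul]
      calc _ ≤ (‖a‖ * ‖x‖) * (‖a‖ * ‖x‖) := by gcongr <;> apply hin
        _ = _ := by ring
  have i2 := (integrable_norm_pow_stdGaussian (E := E) 2).const_mul (‖a‖ ^ 2)
  have := integral_mul_inner_stdGaussian (h := fun x : E => (inner ℝ a x : ℝ) * ‖x‖ ^ 2)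
    (fun x => (hder x).differentiableAt) a
    (integrable_stdGaussian_of_norm_le (by fun_prop) ‖a‖ 3 fun x => by
      rw [abs_mul, abs_of_nonneg (by positivity : 0 ≤ ‖x‖ ^ 2)]
      calc _ ≤ (‖a‖ * ‖x‖) * ‖x‖ ^ 2 := by gcongr; apply hin
        _ = _ := by ring)
    (integrable_stdGaussian_of_norm_le (by fun_prop) (‖a‖ * ‖a‖) 4 fun x => by
      rw [abs_mul, abs_mul, abs_of_nonneg (by positivity : 0 ≤ ‖x‖ ^ 2), real_inner_comm a]
      calc _ ≤ (‖a‖ * ‖x‖) * ‖x‖ ^ 2 * (‖a‖ * ‖x‖) := by gcongr <;> apply hin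
        _ = _ := by ring)
    (by simp_rw [hval]; exact (i1.const_mul 2).add i2)
  simp_rw [hval] at this
  rw [integral_add (i1.const_mul 2) i2, integral_const_mul, integral_const_mul,
    integral_inner_mul_inner_stdGaussian, integral_norm_pow_two_stdGaussian] at this
  rw [real_inner_self_eq_norm_sq] at this
  rw [show (finrank ℝ E + 2) * ‖a‖ ^ 2 = 2 * ‖a‖ ^ 2 + ‖a‖ ^ 2 * finrank ℝ E by ring, ← this]
  congr 1
  ext x
  rw [real_inner_comm x a]; ring

end Gaussian

/-! ### Quadratic bounds for functions with Lipschitz gradient. -/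

section Smooth

variable {n : ℕ} {L : ℝ} {g : EuclideanSpace ℝ (Fin n) → ℝ}

lemma IsC11.hasGradientAt (hg : IsC11 L g) (x : EuclideanSpace ℝ (Fin n)) :
    HasGradientAt g (∇ g x) x :=
  (hg.1 x).hasGradientAt

lemma IsC11.neg (hg : IsC11 L g) : IsC11 L (fun x => -g x) := by
  have h : ∀ x, ∇ (fun x => -g x) x = -∇ g x := fun x => by
    refine HasGradientAt.gradient ?_
    rw [hasGradientAt_iff_hasFDerivAt, map_neg]
    exact (hg.hasGradientAt x).hasFDerivAt.neg
  refine ⟨hg.1.neg, fun x y => ?_⟩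
  rw [h, h, neg_sub_neg, norm_sub_rev]
  exact hg.2 x y

lemma IsC11.continuous_gradient (hg : IsC11 L g) : Continuous (∇ g) :=
  (LipschitzWith.of_dist_le_mul (K := L.toNNReal) fun x y => by
    rw [dist_eq_norm, dist_eq_norm]
    refine (hg.2 y x).trans ?_
    gcongr
    exact Real.le_coe_toNNReal L).continuous

lemma hasDerivAt_comp_add_smul {a : EuclideanSpace ℝ (Fin n)} {x d : EuclideanSpace ℝ (Fin n)}
    {t : ℝ} (h : HasGradientAt g a (x + t • d)) :
    HasDerivAt (fun t : ℝ => g (x + t • d)) (inner ℝ a d) t := by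
  have h1 : HasDerivAt (fun t : ℝ => x + t • d) d t := by
    simpa using ((hasDerivAt_id t).smul_const d).const_add x
  exact (h.hasFDerivAt.comp_hasDerivAt t h1).congr_deriv (by simp)

/-- On the segment from x to y the derivative of g is dominated by that of the quadratic on the
right, and the two agree at x. -/
lemma IsC11.le_quadratic (hg : IsC11 L g) (x y : EuclideanSpace ℝ (Fin n)) :
    g y ≤ g x + inner ℝ (∇ g x) (y - x) + L / 2 * ‖y - x‖ ^ 2 := by
  set d := y - x with hd
  have hder : ∀ t : ℝ, HasDerivAt (fun t : ℝ => g (x + t • d)) (inner ℝ (∇ g (x + t • d)) d) t :=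
    fun t => hasDerivAt_comp_add_smul (hg.hasGradientAt _)
  have hB : ∀ t : ℝ, HasDerivAt
      (fun t : ℝ => g x + t * inner ℝ (∇ g x) d + L / 2 * t ^ 2 * ‖d‖ ^ 2)
      (inner ℝ (∇ g x) d + L * t * ‖d‖ ^ 2) t := by
    intro t
    have h1 := ((hasDerivAt_id t).mul_const (inner ℝ (∇ g x) d)).const_add (g x)
    have h2 := ((((hasDerivAt_id t).pow 2).const_mul (L / 2)).mul_const (‖d‖ ^ 2))
    refine (h1.add h2).congr_deriv ?_
    simp only [id, one_mul, mul_one, Nat.cast_ofNat, Nat.add_one_sub_one, pow_one]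
    ring
  have := image_le_of_deriv_right_le_deriv_boundary (a := 0) (b := 1)
    (fun t _ => (hder t).continuousAt.continuousWithinAt)
    (fun t _ => (hder t).hasDerivWithinAt) (by simp)
    (fun t _ => (hB t).continuousAt.continuousWithinAt)
    (fun t _ => (hB t).hasDerivWithinAt) (fun t ht => by
      have h1 : inner ℝ (∇ g (x + t • d)) d - inner ℝ (∇ g x) d ≤ L * t * ‖d‖ ^ 2 := by
        rw [← inner_sub_left]
        refine (real_inner_le_norm _ _).trans ?_
        have := hg.2 x (x + t • d)
        rw [add_sub_cancel_left, norm_smul, Real.norm_of_nonneg ht.1] at this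
        calc _ ≤ L * (t * ‖d‖) * ‖d‖ := by gcongr
          _ = _ := by ring
      linarith) (Set.right_mem_Icc.2 zero_le_one)
  simpa [hd] using this

lemma IsC11.abs_sub_le_quadratic (hg : IsC11 L g) (x y : EuclideanSpace ℝ (Fin n)) :
    |g y - g x - inner ℝ (∇ g x) (y - x)| ≤ L / 2 * ‖y - x‖ ^ 2 := by
  have h1 := hg.le_quadratic x y
  have h2 := hg.neg.le_quadratic x y
  have h : ∇ (fun x => -g x) x = -∇ g x := by
    refine HasGradientAt.gradient ?_
    rw [hasGradientAt_iff_hasFDerivAt, map_neg]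
    exact (hg.hasGradientAt x).hasFDerivAt.neg
  rw [h, inner_neg_left] at h2
  rw [abs_le]
  constructor <;> linarith

/-- A gradient step of length 1/L decreases g by at least ‖∇g‖²/(2L) and cannot go below m. -/
lemma IsC11.norm_gradient_sq_le (hL : 0 < L) (hg : IsC11 L g) {m : ℝ} (hm : ∀ y, m ≤ g y)
    (x : EuclideanSpace ℝ (Fin n)) : ‖∇ g x‖ ^ 2 ≤ 2 * L * (g x - m) := by
  have h := (hm _).trans (hg.le_quadratic x (x - L⁻¹ • ∇ g x))
  rw [show x - L⁻¹ • ∇ g x - x = -(L⁻¹ • ∇ g x) by abel, norm_neg, norm_smul, inner_neg_right,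
    inner_smul_right, real_inner_self_eq_norm_sq, Real.norm_of_nonneg (by positivity)] at h
  have : L⁻¹ * ‖∇ g x‖ ^ 2 - L / 2 * (L⁻¹ * ‖∇ g x‖) ^ 2 = ‖∇ g x‖ ^ 2 / (2 * L) := by
    field_simp; ring
  have h2 : ‖∇ g x‖ ^ 2 / (2 * L) ≤ g x - m := by linarith
  rwa [div_le_iff₀ (by positivity), mul_comm] at h2

lemma ConvexOn.add_inner_gradient_le (hc : ConvexOn ℝ Set.univ g) (hg : Differentiable ℝ g)
    (x y : EuclideanSpace ℝ (Fin n)) : g x + inner ℝ (∇ g x) (y - x) ≤ g y := by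
  have hc' : ConvexOn ℝ Set.univ (fun t : ℝ => g (x + t • (y - x))) := by
    have := hc.comp_affineMap (AffineMap.lineMap x y : ℝ →ᵃ[ℝ] EuclideanSpace ℝ (Fin n))
    simpa [Function.comp_def, AffineMap.lineMap_apply, add_comm] using this
  have h0 : HasDerivAt (fun t : ℝ => g (x + t • (y - x))) (inner ℝ (∇ g x) (y - x)) 0 :=
    hasDerivAt_comp_add_smul (by simpa using (hg x).hasGradientAt)
  have := hc'.le_slope_of_hasDerivAt (Set.mem_univ 0) (Set.mem_univ 1) zero_lt_one h0
  simp only [slope_def_field, one_smul, zero_smul, add_zero, sub_zero, div_one,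
    add_sub_cancel] at this
  linarith

end Smooth

/-! ### Measurability of the stochastic gradient and smoothness of the averaged objective. -/

section Objective

variable {n : ℕ} {Ξ : Type*}

/-- The gradient of `F(·, s)` at `x` written as a limit of difference quotients; it is jointly
measurable in `(x, s)`. -/
noncomputable def limGrad (F : EuclideanSpace ℝ (Fin n) → Ξ → ℝ)
    (p : EuclideanSpace ℝ (Fin n) × Ξ) : EuclideanSpace ℝ (Fin n) :=
  ∑ i, Filter.limsup (fun j : ℕ => (j : ℝ) *
    (F (p.1 + (j : ℝ)⁻¹ • EuclideanSpace.basisFun (Fin n) ℝ i) p.2 - F p.1 p.2)) Filter.atTop •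
      EuclideanSpace.basisFun (Fin n) ℝ i

lemma stochGrad_eq_limGrad {F : EuclideanSpace ℝ (Fin n) → Ξ → ℝ} {s : Ξ}
    (h : Differentiable ℝ fun x => F x s) (x : EuclideanSpace ℝ (Fin n)) :
    stochGrad F x s = limGrad F (x, s) := by
  have h1 : ∀ d : EuclideanSpace ℝ (Fin n), Filter.limsup (fun j : ℕ => (j : ℝ) *
      (F (x + (j : ℝ)⁻¹ • d) s - F x s)) Filter.atTop = inner ℝ d (stochGrad F x s) := by
    intro d
    have := ((h x).hasFDerivAt.lim_real d).comp (tendsto_natCast_atTop_atTop (R := ℝ))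
    refine (this.limsup_eq).trans ?_
    rw [stochGrad, real_inner_comm, inner_gradient_left]
  simp only [limGrad, h1]
  exact ((EuclideanSpace.basisFun (Fin n) ℝ).sum_repr' _).symm

variable [MeasurableSpace Ξ]

lemma measurable_limGrad {F : EuclideanSpace ℝ (Fin n) → Ξ → ℝ}
    (hF : Measurable (Function.uncurry F)) : Measurable (limGrad F) := by
  unfold limGrad
  refine Finset.measurable_sum _ fun i _ => Measurable.smul_const (Measurable.limsup fun j => ?_) _
  refine Measurable.const_mul (Measurable.sub ?_ hF) _
  exact hF.comp (f := fun p : EuclideanSpace ℝ (Fin n) × Ξ =>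
    (p.1 + (j : ℝ)⁻¹ • EuclideanSpace.basisFun (Fin n) ℝ i, p.2)) (by fun_prop)

/-- An average of `C^{1,1}_L` functions is `C^{1,1}_L`. -/
theorem isC11_objective {P : Measure Ξ} [IsProbabilityMeasure P]
    {F : EuclideanSpace ℝ (Fin n) → Ξ → ℝ} (hF : Measurable (Function.uncurry F))
    (hFint : ∀ x, Integrable (F x) P) {L : ℝ} (hFP : ∀ᵐ s ∂P, IsC11 L (fun x => F x s)) :
    IsC11 L (objective F P) := by
  have hmeas : ∀ x, AEStronglyMeasurable (fun s => stochGrad F x s) P := fun x => by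
    refine ⟨fun s => limGrad F (x, s), ((measurable_limGrad hF).comp (by fun_prop :
      Measurable fun s : Ξ => (x, s))).stronglyMeasurable, ?_⟩
    filter_upwards [hFP] with s hs using stochGrad_eq_limGrad hs.1 x
  have hinner : ∀ x d, Integrable (fun s => inner ℝ d (stochGrad F x s)) P := by
    intro x d
    -- The quadratic bound controls each directional derivative by a difference of two integrable
    -- function values plus a constant.
    refine Integrable.mono' ((((hFint (x + d)).sub (hFint x)).norm).add
      (integrable_const (L / 2 * ‖d‖ ^ 2))) (aestronglyMeasurable_const.inner (hmeas x)) ?_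
    filter_upwards [hFP] with s hs
    have := hs.abs_sub_le_quadratic x (x + d)
    rw [add_sub_cancel_left, real_inner_comm] at this
    simp only [Pi.add_apply, Pi.sub_apply, Real.norm_eq_abs]
    rw [abs_le] at this ⊢
    have h1 := neg_abs_le (F (x + d) s - F x s)
    have h2 := le_abs_self (F (x + d) s - F x s)
    unfold stochGrad
    constructor <;> linarith
  have hint : ∀ x, Integrable (fun s => stochGrad F x s) P := by
    intro x
    have : (fun s => stochGrad F x s) = fun s => ∑ i,
        (inner ℝ (EuclideanSpace.basisFun (Fin n) ℝ i) (stochGrad F x s) : ℝ) •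
          EuclideanSpace.basisFun (Fin n) ℝ i :=
      funext fun s => ((EuclideanSpace.basisFun (Fin n) ℝ).sum_repr' _).symm
    rw [this]
    exact integrable_finsetSum _ fun i _ => (hinner x _).smul_const _
  -- Integrating the two-sided quadratic bound over s leaves a remainder of order ‖y - x‖², which
  -- identifies the gradient of the average without a separate theorem on differentiating under the
  -- integral.
  have hquad : ∀ x y, |objective F P y - objective F P x
      - inner ℝ (∫ s, stochGrad F x s ∂P) (y - x)| ≤ L / 2 * ‖y - x‖ ^ 2 := by
    intro x y
    have e : objective F P y - objective F P x - inner ℝ (∫ s, stochGrad F x s ∂P) (y - x)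
        = ∫ s, (F y s - F x s - inner ℝ (y - x) (stochGrad F x s)) ∂P := by
      rw [integral_sub (f := fun s => F y s - F x s) ((hFint y).sub (hFint x)) (hinner x _),
        integral_sub (hFint y) (hFint x), integral_inner (hint x), real_inner_comm]
      rfl
    rw [e, ← Real.norm_eq_abs]
    refine (norm_integral_le_of_norm_le_const (C := L / 2 * ‖y - x‖ ^ 2) ?_).trans (by simp)
    filter_upwards [hFP] with s hs
    rw [Real.norm_eq_abs, real_inner_comm]
    exact hs.abs_sub_le_quadratic x y
  have hgrad : ∀ x, HasGradientAt (objective F P) (∫ s, stochGrad F x s ∂P) x := by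
    intro x
    rw [hasGradientAt_iff_isLittleO]
    have h1 : (fun y => objective F P y - objective F P x
        - inner ℝ (∫ s, stochGrad F x s ∂P) (y - x)) =O[nhds x] fun y => ‖y - x‖ ^ 2 :=
      Asymptotics.IsBigO.of_bound (L / 2) (Filter.Eventually.of_forall fun y => by
        simpa using hquad x y)
    refine h1.trans_isLittleO ?_
    have h2 : (fun y => ‖y - x‖ ^ 2) =o[nhds x] fun y => ‖y - x‖ := by
      have := (Asymptotics.isLittleO_pow_id (𝕜 := ℝ) one_lt_two).comp_tendsto
        (k := fun y : EuclideanSpace ℝ (Fin n) => ‖y - x‖) (l' := nhds x) (by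
          have : Continuous fun y : EuclideanSpace ℝ (Fin n) => ‖y - x‖ := by fun_prop
          simpa using this.tendsto x)
      exact this
    exact h2.trans_isBigO (Asymptotics.isBigO_norm_left.2 (Asymptotics.isBigO_refl _ _))
  refine ⟨fun x => (hgrad x).differentiableAt, fun x y => ?_⟩
  rw [(hgrad x).gradient, (hgrad y).gradient, ← integral_sub (hint y) (hint x)]
  refine (norm_integral_le_of_norm_le_const (C := L * ‖y - x‖) ?_).trans (by simp)
  filter_upwards [hFP] with s hs using hs.2 x y

end Objective

/-! ### Moments of estimators built from an independent Gaussian direction. -/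

section Step

variable {n : ℕ} {Ω : Type*} [MeasurableSpace Ω] {Pr : Measure Ω}

section SecondMoments

variable {V : Type*} [NormedAddCommGroup V] {X Y : Ω → V}

lemma MeasureTheory.MemLp.integrable_norm_sq (hX : MemLp X 2 Pr) :
    Integrable (fun ω => ‖X ω‖ ^ 2) Pr :=
  (memLp_two_iff_integrable_sq_norm hX.1).1 hX

lemma MeasureTheory.MemLp.integrable_inner_two [InnerProductSpace ℝ V] (hX : MemLp X 2 Pr) (hY : MemLp Y 2 Pr) :
    Integrable (fun ω => (inner ℝ (X ω) (Y ω) : ℝ)) Pr := by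
  refine (hX.integrable_norm_sq.add hY.integrable_norm_sq).mono' (hX.1.inner hY.1)
    (ae_of_all _ fun ω => ?_)
  refine (norm_inner_le_norm _ _).trans ?_
  simp only [Pi.add_apply]
  nlinarith [sq_nonneg (‖X ω‖ - ‖Y ω‖), sq_nonneg ‖X ω‖, sq_nonneg ‖Y ω‖]

end SecondMoments

lemma IsC11.memLp_gradient_comp [IsFiniteMeasure Pr] {L : ℝ} {f : EuclideanSpace ℝ (Fin n) → ℝ}
    (hf : IsC11 L f) {X : Ω → EuclideanSpace ℝ (Fin n)} (hX : MemLp X 2 Pr) :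
    MemLp (fun ω => ∇ f (X ω)) 2 Pr := by
  refine MemLp.mono' (g := fun ω => L * ‖X ω‖ + ‖∇ f 0‖)
    ((hX.norm.const_mul L).add (memLp_const _))
    (hf.continuous_gradient.comp_aestronglyMeasurable hX.1) (ae_of_all _ fun ω => ?_)
  have := hf.2 0 (X ω)
  rw [sub_zero] at this
  linarith [norm_le_norm_sub_add (∇ f (X ω)) (∇ f 0)]

lemma IsC11.integrable_comp [IsFiniteMeasure Pr] {L : ℝ} {f : EuclideanSpace ℝ (Fin n) → ℝ}
    (hf : IsC11 L f) {X : Ω → EuclideanSpace ℝ (Fin n)} (hX : MemLp X 2 Pr) :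
    Integrable (fun ω => f (X ω)) Pr := by
  refine Integrable.mono' (g := fun ω => |f 0| + ‖∇ f 0‖ * ‖X ω‖ + L / 2 * ‖X ω‖ ^ 2)
    (((integrable_const _).add (((hX.integrable (by norm_num)).norm).const_mul _)).add
      (hX.integrable_norm_sq.const_mul _))
    (hf.1.continuous.comp_aestronglyMeasurable hX.1) (ae_of_all _ fun ω => ?_)
  have h1 := hf.abs_sub_le_quadratic 0 (X ω)
  rw [sub_zero] at h1
  have h2 := abs_real_inner_le_norm (∇ f 0) (X ω)
  rw [Real.norm_eq_abs]
  rw [abs_le] at h1 h2 ⊢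
  have h3 := neg_abs_le (f 0)
  have h4 := le_abs_self (f 0)
  constructor <;> linarith

variable {U : Ω → EuclideanSpace ℝ (Fin n)}

lemma integrable_norm_pow_of_law (hU : Measurable U)
    (hlaw : Pr.map U = stdGaussian (EuclideanSpace ℝ (Fin n))) (k : ℕ) :
    Integrable (fun ω => ‖U ω‖ ^ k) Pr := by
  have := integrable_norm_pow_stdGaussian (E := EuclideanSpace ℝ (Fin n)) k
  rw [← hlaw] at this
  exact (integrable_map_measure (by fun_prop) hU.aemeasurable).1 this

lemma integral_norm_pow_six_of_law (hU : Measurable U)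
    (hlaw : Pr.map U = stdGaussian (EuclideanSpace ℝ (Fin n))) :
    ∫ ω, ‖U ω‖ ^ 6 ∂Pr = n * (n + 2) * (n + 4) := by
  have := integral_norm_pow_six_stdGaussian (E := EuclideanSpace ℝ (Fin n))
  rw [← hlaw, integral_map hU.aemeasurable (by fun_prop)] at this
  simpa using this

variable {Z g W : Ω → EuclideanSpace ℝ (Fin n)} {c : ℝ}

lemma integrable_norm_sq_mul_norm_pow (hU : Measurable U)
    (hlaw : Pr.map U = stdGaussian (EuclideanSpace ℝ (Fin n)))
    (hZ2 : MemLp Z 2 Pr) (hind : IndepFun Z U Pr) (k : ℕ) :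
    Integrable (fun ω => ‖Z ω‖ ^ 2 * ‖U ω‖ ^ k) Pr :=
  (hind.comp (φ := fun z => ‖z‖ ^ 2) (ψ := fun v => ‖v‖ ^ k) (by fun_prop)
    (by fun_prop)).integrable_mul hZ2.integrable_norm_sq (integrable_norm_pow_of_law hU hlaw k)

variable [IsProbabilityMeasure Pr]

/-- Independence makes the joint law a product, so Fubini integrates the direction out with Y
frozen. -/
lemma integral_comp_indep_stdGaussian {β : Type*} [MeasurableSpace β] {Y : Ω → β}
    (hY : Measurable Y) (hU : Measurable U)
    (hlaw : Pr.map U = stdGaussian (EuclideanSpace ℝ (Fin n))) (hind : IndepFun Y U Pr)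
    {φ : β × EuclideanSpace ℝ (Fin n) → ℝ} (hφ : Measurable φ)
    (hint : Integrable (fun ω => φ (Y ω, U ω)) Pr) :
    Integrable (fun ω => ∫ v, φ (Y ω, v) ∂(stdGaussian (EuclideanSpace ℝ (Fin n)))) Pr ∧
    ∫ ω, φ (Y ω, U ω) ∂Pr
      = ∫ ω, ∫ v, φ (Y ω, v) ∂(stdGaussian (EuclideanSpace ℝ (Fin n))) ∂Pr := by
  have hmap := (indepFun_iff_map_prod_eq_prod_map_map hY.aemeasurable hU.aemeasurable).1 hind
  rw [hlaw] at hmap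
  have : IsProbabilityMeasure (Pr.map Y) := Measure.isProbabilityMeasure_map hY.aemeasurable
  have hint' : Integrable φ ((Pr.map Y).prod (stdGaussian (EuclideanSpace ℝ (Fin n)))) := by
    rw [← hmap]
    exact (integrable_map_measure hφ.aestronglyMeasurable
      (hY.prodMk hU).aemeasurable).2 hint
  refine ⟨(integrable_map_measure hint'.integral_prod_left.1 hY.aemeasurable).1
    hint'.integral_prod_left, ?_⟩
  rw [← integral_map (f := φ) (φ := fun ω => (Y ω, U ω)) (hY.prodMk hU).aemeasurable
    hφ.aestronglyMeasurable, hmap, integral_prod _ hint',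
    integral_map hY.aemeasurable hint'.integral_prod_left.1]

/-- The second moment of an estimator that is close to the directional estimator `⟪Z, U⟫ U`. -/
lemma secondMoment_estimator (hZ : Measurable Z) (hU : Measurable U)
    (hlaw : Pr.map U = stdGaussian (EuclideanSpace ℝ (Fin n)))
    (hZ2 : MemLp Z 2 Pr) (hind : IndepFun Z U Pr)
    (hW : AEStronglyMeasurable W Pr)
    (hWZ : ∀ᵐ ω ∂Pr, ‖W ω - (inner ℝ (Z ω) (U ω) : ℝ) • U ω‖ ≤ c * ‖U ω‖ ^ 3) :
    MemLp W 2 Pr ∧ ∫ ω, ‖W ω‖ ^ 2 ∂Pr ≤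
      2 * (n + 2) * ∫ ω, ‖Z ω‖ ^ 2 ∂Pr + 2 * c ^ 2 * (n * (n + 2) * (n + 4)) := by
  have i1 : Integrable (fun ω => (inner ℝ (Z ω) (U ω) : ℝ) ^ 2 * ‖U ω‖ ^ 2) Pr := by
    refine (integrable_norm_sq_mul_norm_pow hU hlaw hZ2 hind 4).mono' (by fun_prop)
      (ae_of_all _ fun ω => ?_)
    have := abs_real_inner_le_norm (Z ω) (U ω)
    rw [Real.norm_of_nonneg (by positivity), ← sq_abs]
    calc _ ≤ (‖Z ω‖ * ‖U ω‖) ^ 2 * ‖U ω‖ ^ 2 := by gcongr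
      _ = _ := by ring
  have i2 := integrable_norm_pow_of_law hU hlaw 6
  have hb : ∀ᵐ ω ∂Pr, ‖W ω‖ ^ 2 ≤
      2 * ((inner ℝ (Z ω) (U ω) : ℝ) ^ 2 * ‖U ω‖ ^ 2) + 2 * c ^ 2 * ‖U ω‖ ^ 6 := by
    filter_upwards [hWZ] with ω hω
    have h1 : ‖W ω‖ ≤ |(inner ℝ (Z ω) (U ω) : ℝ)| * ‖U ω‖ + c * ‖U ω‖ ^ 3 := by
      have := norm_le_norm_sub_add (W ω) ((inner ℝ (Z ω) (U ω) : ℝ) • U ω)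
      rw [norm_smul, Real.norm_eq_abs] at this
      linarith
    calc ‖W ω‖ ^ 2 ≤ (|(inner ℝ (Z ω) (U ω) : ℝ)| * ‖U ω‖ + c * ‖U ω‖ ^ 3) ^ 2 := by gcongr
      _ ≤ 2 * (|(inner ℝ (Z ω) (U ω) : ℝ)| * ‖U ω‖) ^ 2 + 2 * (c * ‖U ω‖ ^ 3) ^ 2 := by
        nlinarith [sq_nonneg (|(inner ℝ (Z ω) (U ω) : ℝ)| * ‖U ω‖ - c * ‖U ω‖ ^ 3)]
      _ = _ := by rw [mul_pow, sq_abs]; ring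
  have i3 : Integrable (fun ω => ‖W ω‖ ^ 2) Pr := by
    refine ((i1.const_mul 2).add (i2.const_mul (2 * c ^ 2))).mono' (by fun_prop) ?_
    filter_upwards [hb] with ω hω
    rw [Real.norm_of_nonneg (by positivity)]
    exact hω
  refine ⟨(memLp_two_iff_integrable_sq_norm hW).2 i3, ?_⟩
  have h1 := integral_mono_ae i3 ((i1.const_mul 2).add (i2.const_mul (2 * c ^ 2))) hb
  have h2 : ∫ ω, (inner ℝ (Z ω) (U ω) : ℝ) ^ 2 * ‖U ω‖ ^ 2 ∂Pr
      = (n + 2) * ∫ ω, ‖Z ω‖ ^ 2 ∂Pr := by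
    rw [(integral_comp_indep_stdGaussian hZ hU hlaw hind
      (φ := fun p => (inner ℝ p.1 p.2 : ℝ) ^ 2 * ‖p.2‖ ^ 2) (by fun_prop) i1).2]
    simp_rw [integral_inner_sq_mul_norm_sq_stdGaussian]
    rw [integral_const_mul, finrank_euclideanSpace_fin]
  simp only [Pi.add_apply] at h1
  rw [integral_add (i1.const_mul 2) (i2.const_mul (2 * c ^ 2)), integral_const_mul,
    integral_const_mul, h2, integral_norm_pow_six_of_law hU hlaw] at h1
  linarith

/-- The correlation of a vector with an estimator that is close to `⟪Z, U⟫ U`. -/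
lemma inner_estimator_ge (hZ : Measurable Z) (hg : Measurable g) (hU : Measurable U)
    (hlaw : Pr.map U = stdGaussian (EuclideanSpace ℝ (Fin n)))
    (hZ2 : MemLp Z 2 Pr) (hg2 : MemLp g 2 Pr)
    (hind : IndepFun (fun ω => (g ω, Z ω)) U Pr) (hW : MemLp W 2 Pr)
    (hWZ : ∀ᵐ ω ∂Pr, ‖W ω - (inner ℝ (Z ω) (U ω) : ℝ) • U ω‖ ≤ c * ‖U ω‖ ^ 3) :
    ∫ ω, inner ℝ (g ω) (Z ω) ∂Pr - 1 / 2 * ∫ ω, ‖g ω‖ ^ 2 ∂Pr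
      - c ^ 2 / 2 * (n * (n + 2) * (n + 4)) ≤ ∫ ω, inner ℝ (g ω) (W ω) ∂Pr := by
  have hindZ : IndepFun Z U Pr := hind.comp (φ := Prod.snd) (ψ := id) measurable_snd measurable_id
  have hindg : IndepFun g U Pr := hind.comp (φ := Prod.fst) (ψ := id) measurable_fst measurable_id
  have i1 : Integrable (fun ω => (inner ℝ (g ω) (U ω) : ℝ) * inner ℝ (Z ω) (U ω)) Pr := by
    refine ((integrable_norm_sq_mul_norm_pow hU hlaw hZ2 hindZ 2).add
      (integrable_norm_sq_mul_norm_pow hU hlaw hg2 hindg 2)).mono' (by fun_prop)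
      (ae_of_all _ fun ω => ?_)
    have h1 := abs_real_inner_le_norm (Z ω) (U ω)
    have h2 := abs_real_inner_le_norm (g ω) (U ω)
    rw [Real.norm_eq_abs, abs_mul]
    calc _ ≤ (‖g ω‖ * ‖U ω‖) * (‖Z ω‖ * ‖U ω‖) := by gcongr
      _ ≤ ‖Z ω‖ ^ 2 * ‖U ω‖ ^ 2 + ‖g ω‖ ^ 2 * ‖U ω‖ ^ 2 := by
        nlinarith [sq_nonneg (‖g ω‖ * ‖U ω‖ - ‖Z ω‖ * ‖U ω‖), sq_nonneg (‖g ω‖ * ‖U ω‖),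
          sq_nonneg (‖Z ω‖ * ‖U ω‖)]
  have i2 := (integrable_norm_pow_of_law hU hlaw 6).const_mul (c ^ 2 / 2)
  have i3 := hg2.integrable_norm_sq.const_mul (1 / 2 : ℝ)
  -- Young's inequality splits the error ‖g‖ · c‖U‖³ into ½‖g‖² and ½c²‖U‖⁶; half of the main term
  -- survives when E⟪g, Z⟫ = E‖g‖².
  have hb : ∀ᵐ ω ∂Pr, (inner ℝ (g ω) (U ω) : ℝ) * inner ℝ (Z ω) (U ω) - 1 / 2 * ‖g ω‖ ^ 2
      - c ^ 2 / 2 * ‖U ω‖ ^ 6 ≤ inner ℝ (g ω) (W ω) := by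
    filter_upwards [hWZ] with ω hω
    have h1 := abs_real_inner_le_norm (g ω) (W ω - (inner ℝ (Z ω) (U ω) : ℝ) • U ω)
    rw [inner_sub_right, inner_smul_right] at h1
    have h2 := (abs_le.1 h1).1
    have h3 : ‖g ω‖ * ‖W ω - (inner ℝ (Z ω) (U ω) : ℝ) • U ω‖ ≤ ‖g ω‖ * (c * ‖U ω‖ ^ 3) := by
      gcongr
    nlinarith [sq_nonneg (‖g ω‖ - c * ‖U ω‖ ^ 3)]
  have h1 := integral_mono_ae ((i1.sub i3).sub i2) (hg2.integrable_inner_two hW) hb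
  have h2 : ∫ ω, (inner ℝ (g ω) (U ω) : ℝ) * inner ℝ (Z ω) (U ω) ∂Pr
      = ∫ ω, inner ℝ (g ω) (Z ω) ∂Pr := by
    rw [(integral_comp_indep_stdGaussian (hg.prodMk hZ) hU hlaw hind
      (φ := fun p => (inner ℝ p.1.1 p.2 : ℝ) * inner ℝ p.1.2 p.2) (by fun_prop) i1).2]
    simp_rw [integral_inner_mul_inner_stdGaussian]
  simp only [Pi.sub_apply] at h1
  rw [integral_sub (f := fun ω => (inner ℝ (g ω) (U ω) : ℝ) * inner ℝ (Z ω) (U ω)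
    - 1 / 2 * ‖g ω‖ ^ 2) (i1.sub i3) i2, integral_sub i1 i3, integral_const_mul, integral_const_mul, h2,
    integral_norm_pow_six_of_law hU hlaw] at h1
  linarith

/-- Gaussian smoothing of a smooth convex function: a lower bound for the correlation of the
finite-difference estimator with the direction from a reference point. -/
lemma integral_finiteDiff_mul_inner_ge {L : ℝ} {f : EuclideanSpace ℝ (Fin n) → ℝ}
    (hf : IsC11 L f) (hc : ConvexOn ℝ Set.univ f) {μ : ℝ} (hμ : 0 < μ)
    (x y : EuclideanSpace ℝ (Fin n)) :
    f x - f y - μ ^ 2 * L * n / 2 ≤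
      ∫ v, (f (x + μ • v) - f x) / μ * inner ℝ v (x - y)
        ∂(stdGaussian (EuclideanSpace ℝ (Fin n))) := by
  set ν := stdGaussian (EuclideanSpace ℝ (Fin n))
  have hid : MemLp (fun v : EuclideanSpace ℝ (Fin n) => v) 2 ν := IsGaussian.memLp_two_id
  have hshift : ∀ z : EuclideanSpace ℝ (Fin n), MemLp (fun v => z + μ • v) 2 ν :=
    fun z => (memLp_const z).add (hid.const_smul μ)
  have hfz : ∀ z, Integrable (fun v => f (z + μ • v)) ν := fun z => hf.integrable_comp (hshift z)
  -- The factor μ from the chain rule cancels the denominator, so Stein's identity produces ∇f(x +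
  -- μv) exactly.
  have hder : ∀ v, HasFDerivAt (fun v => (f (x + μ • v) - f x) / μ)
      (innerSL ℝ (∇ f (x + μ • v))) v := by
    intro v
    have h1 : HasFDerivAt (fun v : EuclideanSpace ℝ (Fin n) => x + μ • v)
        (μ • ContinuousLinearMap.id ℝ _) v := ((hasFDerivAt_id v).const_smul μ).const_add x
    have h2 := ((hf.hasGradientAt (x + μ • v)).hasFDerivAt.comp v h1).sub_const (f x)
    refine (h2.mul_const μ⁻¹).congr_fderiv ?_
    ext w
    simp
    field_simp
  have hval : ∀ v, fderiv ℝ (fun v => (f (x + μ • v) - f x) / μ) v (x - y)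
      = inner ℝ (∇ f (x + μ • v)) (x - y) := fun v => by rw [(hder v).fderiv]; simp
  have hgrad := hf.memLp_gradient_comp (hshift x)
  have i3 : Integrable (fun v => inner ℝ (∇ f (x + μ • v)) (x - y)) ν :=
    hgrad.integrable_inner_two (memLp_const _)
  have i1 : Integrable (fun v => (f (x + μ • v) - f x) / μ) ν :=
    ((hfz x).sub (integrable_const _)).div_const μ
  have hcont := hf.1.continuous
  have i2 : Integrable (fun v => (f (x + μ • v) - f x) / μ * inner ℝ v (x - y)) ν := by
    refine Integrable.mono' (g := fun v =>
      ((‖∇ f x‖ * ‖x - y‖) * ‖v‖ ^ 2 + (L / 2 * μ * ‖x - y‖) * ‖v‖ ^ 3))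
      (((integrable_norm_pow_stdGaussian 2).const_mul _).add
        ((integrable_norm_pow_stdGaussian 3).const_mul _))
      (Continuous.aestronglyMeasurable (by fun_prop)) (ae_of_all _ fun v => ?_)
    have h1 := hf.abs_sub_le_quadratic x (x + μ • v)
    rw [add_sub_cancel_left, inner_smul_right, norm_smul, Real.norm_of_nonneg hμ.le] at h1
    have h2 := abs_real_inner_le_norm (∇ f x) v
    have h3 := abs_real_inner_le_norm v (x - y)
    have h4 : |(f (x + μ • v) - f x) / μ| ≤ ‖∇ f x‖ * ‖v‖ + L / 2 * μ * ‖v‖ ^ 2 := by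
      rw [abs_div, abs_of_pos hμ, div_le_iff₀ hμ]
      calc |f (x + μ • v) - f x|
          ≤ |f (x + μ • v) - f x - μ * inner ℝ (∇ f x) v| + |μ * inner ℝ (∇ f x) v| := by
            simpa using abs_add_le (f (x + μ • v) - f x - μ * inner ℝ (∇ f x) v)
              (μ * inner ℝ (∇ f x) v)
        _ ≤ L / 2 * (μ * ‖v‖) ^ 2 + μ * (‖∇ f x‖ * ‖v‖) := by
            rw [abs_mul μ, abs_of_pos hμ]; gcongr
        _ = _ := by ring
    rw [Real.norm_eq_abs, abs_mul]
    calc _ ≤ (‖∇ f x‖ * ‖v‖ + L / 2 * μ * ‖v‖ ^ 2) * (‖v‖ * ‖x - y‖) :=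
          mul_le_mul h4 h3 (abs_nonneg _) ((abs_nonneg _).trans h4)
      _ = _ := by ring
  rw [integral_mul_inner_stdGaussian (fun v => (hder v).differentiableAt) (x - y) i1 i2
    (by simpa only [hval] using i3)]
  simp_rw [hval]
  have hlin : ∀ a : EuclideanSpace ℝ (Fin n), Integrable (fun v => (inner ℝ a v : ℝ)) ν :=
    fun a => (memLp_const a).integrable_inner_two hid
  have hzero : ∀ a : EuclideanSpace ℝ (Fin n), ∫ v, (inner ℝ a v : ℝ) ∂ν = 0 := fun a => by
    rw [integral_inner (hid.integrable (by norm_num)), integral_id_stdGaussian, inner_zero_right]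
  -- Gaussian averaging raises a convex function, because the linear term of the tangent at x has
  -- mean zero. Smoothness bounds the rise at y by (L/2)μ²E‖v‖².
  have hlow : f x ≤ ∫ v, f (x + μ • v) ∂ν := by
    have := integral_mono ((integrable_const (f x)).add ((hlin (∇ f x)).const_mul μ)) (hfz x)
      (fun v => by
        have := hc.add_inner_gradient_le hf.1 x (x + μ • v)
        rwa [add_sub_cancel_left, inner_smul_right] at this)
    simp only [Pi.add_apply] at this
    rwa [integral_add (integrable_const _) ((hlin (∇ f x)).const_mul μ), integral_const_mul,
      hzero, integral_const, probReal_univ, one_smul, mul_zero, add_zero] at this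
  have hsq : Integrable (fun v : EuclideanSpace ℝ (Fin n) => ‖v‖ ^ 2) ν :=
    integrable_norm_pow_stdGaussian 2
  have hup : ∫ v, f (y + μ • v) ∂ν ≤ f y + μ ^ 2 * L * n / 2 := by
    have i4 := ((integrable_const (f y)).add ((hlin (∇ f y)).const_mul μ))
    have i5 := hsq.const_mul (L / 2 * μ ^ 2)
    have := integral_mono (hfz y) (i4.add i5) (fun v => by
        have := hf.le_quadratic y (y + μ • v)
        rwa [add_sub_cancel_left, inner_smul_right, norm_smul, Real.norm_of_nonneg hμ.le,
          mul_pow, ← mul_assoc] at this)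
    simp only [Pi.add_apply] at this
    rw [integral_add (f := fun v => f y + μ * inner ℝ (∇ f y) v) i4 i5, integral_add (integrable_const _) ((hlin (∇ f y)).const_mul μ),
      integral_const_mul, integral_const_mul,
      hzero, integral_const, probReal_univ, one_smul, mul_zero, add_zero,
      integral_norm_pow_two_stdGaussian, finrank_euclideanSpace_fin] at this
    linarith
  -- Both points are shifted by the same μv, so their difference stays x - y.
  have := integral_mono ((hfz x).sub (hfz y)) i3 (fun v => by
    have := hc.add_inner_gradient_le hf.1 (x + μ • v) (y + μ • v)
    rw [show y + μ • v - (x + μ • v) = -(x - y) by abel, inner_neg_right] at this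
    simp only [Pi.sub_apply]
    linarith)
  simp only [Pi.sub_apply] at this
  rw [integral_sub (hfz x) (hfz y)] at this
  linarith

end Step

/-! ### The finite-difference estimator along the trajectory. -/

section Method

lemma norm_zerothGrad_sub_le {n : ℕ} {Ξ : Type*} {F : EuclideanSpace ℝ (Fin n) → Ξ → ℝ} {L μ : ℝ} (hμ : 0 < μ)
    {s : Ξ} (h : IsC11 L fun x => F x s) (x v : EuclideanSpace ℝ (Fin n)) :
    ‖zerothGrad F μ x s v - (inner ℝ (stochGrad F x s) v : ℝ) • v‖ ≤ μ * L / 2 * ‖v‖ ^ 3 := by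
  have h1 := h.abs_sub_le_quadratic x (x + μ • v)
  rw [add_sub_cancel_left, inner_smul_right, norm_smul, Real.norm_of_nonneg hμ.le] at h1
  rw [zerothGrad, ← sub_smul, norm_smul, Real.norm_eq_abs]
  have h2 : |(F (x + μ • v) s - F x s) / μ - inner ℝ (stochGrad F x s) v|
      ≤ μ * L / 2 * ‖v‖ ^ 2 := by
    rw [show (F (x + μ • v) s - F x s) / μ - inner ℝ (stochGrad F x s) v =
      (F (x + μ • v) s - F x s - μ * inner ℝ (stochGrad F x s) v) / μ by field_simp,
      abs_div, abs_of_pos hμ, div_le_iff₀ hμ]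
    refine h1.trans (le_of_eq ?_)
    ring
  calc _ ≤ μ * L / 2 * ‖v‖ ^ 2 * ‖v‖ := by gcongr
    _ = _ := by ring


variable {n : ℕ} {Ξ Ω : Type*} [MeasurableSpace Ξ]
  {ξ : ℕ → Ω → Ξ} {u : ℕ → Ω → EuclideanSpace ℝ (Fin n)}

lemma past_mono {j k : ℕ} (h : j ≤ k) : past ξ u j ≤ past ξ u k :=
  biSup_mono fun i hi => by
    rw [Finset.mem_Ico] at hi ⊢; omega

lemma comap_le_past {j k : ℕ} (h1 : 1 ≤ j) (h : j < k) :
    (MeasurableSpace.comap (ξ j) inferInstance ⊔ MeasurableSpace.comap (u j) inferInstance)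
      ≤ past ξ u k :=
  le_biSup (fun j => MeasurableSpace.comap (ξ j) inferInstance
    ⊔ MeasurableSpace.comap (u j) inferInstance) (Finset.mem_Ico.2 ⟨h1, h⟩)

lemma measurable_zerothGrad {F : EuclideanSpace ℝ (Fin n) → Ξ → ℝ}
    (hF : Measurable (Function.uncurry F)) (μ : ℝ) {m : MeasurableSpace Ω}
    {X U : Ω → EuclideanSpace ℝ (Fin n)} {S : Ω → Ξ}
    (hX : Measurable X) (hS : Measurable S) (hU : Measurable U) :
    Measurable (fun ω => zerothGrad F μ (X ω) (S ω) (U ω)) := by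
  unfold zerothGrad
  have h1 : Measurable (fun ω => F (X ω) (S ω)) := hF.comp (hX.prodMk hS)
  have h2 : Measurable (fun ω => F (X ω + μ • U ω) (S ω)) :=
    hF.comp ((hX.add (hU.const_smul μ)).prodMk hS)
  exact ((h2.sub h1).div_const μ).smul hU

/-- The recursion for the k-th point reads only the data with index below k. This predictability
allows pulling functions of the point out of conditional expectations and gives its independence
from u k. -/
lemma measurable_searchPoint {F : EuclideanSpace ℝ (Fin n) → Ξ → ℝ}
    (hF : Measurable (Function.uncurry F)) (μ : ℝ) (γ : ℕ → ℝ) (x₁ : EuclideanSpace ℝ (Fin n)) :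
    ∀ k, Measurable[past ξ u k] (searchPoint F μ γ x₁ ξ u k)
  | 0 => by
    have : searchPoint F μ γ x₁ ξ u 0 = fun _ => x₁ := funext fun _ => by rw [searchPoint]
    rw [this]; exact measurable_const
  | 1 => by
    have : searchPoint F μ γ x₁ ξ u 1 = fun _ => x₁ := funext fun _ => by rw [searchPoint]
    rw [this]; exact measurable_const
  | k + 2 => by
    have ih := (measurable_searchPoint hF μ γ x₁ (k + 1)).mono
      (past_mono (ξ := ξ) (u := u) (Nat.le_succ (k + 1))) le_rfl
    have hle := comap_le_past (ξ := ξ) (u := u) (Nat.le_add_left 1 k) (Nat.lt_succ_self (k + 1))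
    have h1 : Measurable[past ξ u (k + 2)] (ξ (k + 1)) :=
      (Measurable.of_comap_le (le_sup_left.trans hle))
    have h2 : Measurable[past ξ u (k + 2)] (u (k + 1)) :=
      (Measurable.of_comap_le (le_sup_right.trans hle))
    have : searchPoint F μ γ x₁ ξ u (k + 2) = fun ω => searchPoint F μ γ x₁ ξ u (k + 1) ω
        - γ (k + 1) • zerothGrad F μ (searchPoint F μ γ x₁ ξ u (k + 1) ω) (ξ (k + 1) ω)
            (u (k + 1) ω) := funext fun _ => by rw [searchPoint]
    rw [this]
    exact ih.sub ((measurable_zerothGrad hF μ ih h1 h2).const_smul (γ (k + 1)))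

variable [mΩ : MeasurableSpace Ω]

lemma past_le {N : ℕ} (hξ : ∀ k ∈ Finset.Icc 1 N, Measurable (ξ k))
    (hu : ∀ k ∈ Finset.Icc 1 N, Measurable (u k)) {k : ℕ} (hk : k ≤ N + 1) :
    past ξ u k ≤ mΩ := by
  refine iSup₂_le fun j hj => ?_
  have : j ∈ Finset.Icc 1 N := by
    rw [Finset.mem_Ico] at hj; rw [Finset.mem_Icc]; omega
  exact sup_le (hξ j this).comap_le (hu j this).comap_le

variable {Pr : Measure Ω} [IsProbabilityMeasure Pr] {F : EuclideanSpace ℝ (Fin n) → Ξ → ℝ}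
  {f : EuclideanSpace ℝ (Fin n) → ℝ} {L μ σ : ℝ} {k : ℕ} {X : Ω → EuclideanSpace ℝ (Fin n)}

/-- The stochastic gradient at a square-integrable search point is square integrable, and the
noise is orthogonal to the gradient. -/
lemma UnbiasedGradient.memLp_and_integrals (hf : IsC11 L f)
    (hA : UnbiasedGradient Pr F f σ ξ u k X) (hpast : past ξ u k ≤ mΩ)
    (hX : Measurable[past ξ u k] X) (hX2 : MemLp X 2 Pr) :
    MemLp (fun ω => stochGrad F (X ω) (ξ k ω)) 2 Pr ∧
    ∫ ω, inner ℝ (∇ f (X ω)) (stochGrad F (X ω) (ξ k ω)) ∂Pr = ∫ ω, ‖∇ f (X ω)‖ ^ 2 ∂Pr ∧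
    ∫ ω, ‖stochGrad F (X ω) (ξ k ω)‖ ^ 2 ∂Pr ≤ ∫ ω, ‖∇ f (X ω)‖ ^ 2 ∂Pr + σ ^ 2 := by
  obtain ⟨hint, hcond, hvar⟩ := hA
  have hg2 := hf.memLp_gradient_comp hX2
  have hgm : StronglyMeasurable[past ξ u k] (fun ω => ∇ f (X ω)) :=
    (hf.continuous_gradient.measurable.comp hX).stronglyMeasurable
  set g := fun ω => ∇ f (X ω) with hg
  set Z := fun ω => stochGrad F (X ω) (ξ k ω) with hZ
  have hd2 : MemLp (fun ω => Z ω - g ω) 2 Pr := by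
    refine ⟨hint.1.sub hg2.1, ?_⟩
    rw [eLpNorm_lt_top_iff_lintegral_rpow_enorm_lt_top (by norm_num) (by norm_num)]
    simp only [ENNReal.toReal_ofNat, ENNReal.rpow_ofNat]
    exact hvar.trans_lt ENNReal.ofReal_lt_top
  -- The variance bound controls only Z - g; g is square integrable because ∇f grows at most
  -- linearly.
  have hZ2 : MemLp Z 2 Pr := (memLp_congr_ae (ae_of_all _ fun ω => by simp)).1 (hd2.add hg2)
  -- As g is known from the past, it leaves the conditional expectation, and unbiasedness turns ⟪g,
  -- Z⟫ into ‖g‖².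
  have hpull := condExp_bilin_of_stronglyMeasurable_left (innerSL ℝ) hgm
    (hg2.integrable_inner_two hZ2) hint (m := past ξ u k) (μ := Pr)
  have hinner : ∫ ω, inner ℝ (g ω) (Z ω) ∂Pr = ∫ ω, ‖g ω‖ ^ 2 ∂Pr := by
    rw [← integral_condExp hpast]
    refine integral_congr_ae ?_
    filter_upwards [hpull, hcond] with ω h1 h2
    refine h1.trans ?_
    rw [h2, innerSL_apply_apply, real_inner_self_eq_norm_sq]
  refine ⟨hZ2, hinner, ?_⟩
  have hvar' : ∫ ω, ‖Z ω - g ω‖ ^ 2 ∂Pr ≤ σ ^ 2 := by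
    rw [integral_eq_lintegral_of_nonneg_ae (ae_of_all _ fun ω => by positivity)
      hd2.integrable_norm_sq.1]
    refine ENNReal.toReal_le_of_le_ofReal (by positivity) ?_
    refine (lintegral_mono fun ω => ?_).trans hvar
    rw [← ofReal_norm, ENNReal.ofReal_pow (norm_nonneg _)]
  have hexp : ∫ ω, ‖Z ω - g ω‖ ^ 2 ∂Pr
      = ∫ ω, ‖Z ω‖ ^ 2 ∂Pr - 2 * ∫ ω, inner ℝ (g ω) (Z ω) ∂Pr + ∫ ω, ‖g ω‖ ^ 2 ∂Pr := by
    have i1 := hZ2.integrable_norm_sq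
    have i2 := (hg2.integrable_inner_two hZ2).const_mul 2
    rw [← integral_const_mul, ← integral_sub i1 i2,
      ← integral_add (f := fun ω => ‖Z ω‖ ^ 2 - 2 * inner ℝ (g ω) (Z ω)) (i1.sub i2)
      hg2.integrable_norm_sq]
    refine integral_congr_ae (ae_of_all _ fun ω => ?_)
    simp only
    rw [norm_sub_sq_real, real_inner_comm]
  rw [hinner] at hexp
  linarith

/-- Moments of the finite-difference estimator at a search point that is determined by the past. -/
theorem zerothGrad_moments (hF : Measurable (Function.uncurry F)) (hf : IsC11 L f) (hμ : 0 < μ)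
    (hpast : past ξ u k ≤ mΩ) (hξ : Measurable (ξ k))
    (hFξ : ∀ᵐ ω ∂Pr, IsC11 L (fun x => F x (ξ k ω))) (hu : Measurable (u k))
    (hlaw : Pr.map (u k) = stdGaussian (EuclideanSpace ℝ (Fin n)))
    (hindep : Indep (MeasurableSpace.comap (u k) inferInstance)
        (past ξ u k ⊔ MeasurableSpace.comap (ξ k) inferInstance) Pr)
    (hA : UnbiasedGradient Pr F f σ ξ u k X)
    (hX : Measurable[past ξ u k] X) (hX2 : MemLp X 2 Pr) :
    MemLp (fun ω => zerothGrad F μ (X ω) (ξ k ω) (u k ω)) 2 Pr ∧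
    ∫ ω, ‖zerothGrad F μ (X ω) (ξ k ω) (u k ω)‖ ^ 2 ∂Pr ≤
      2 * (n + 2) * (∫ ω, ‖∇ f (X ω)‖ ^ 2 ∂Pr + σ ^ 2)
        + 2 * (μ * L / 2) ^ 2 * (n * (n + 2) * (n + 4)) ∧
    1 / 2 * ∫ ω, ‖∇ f (X ω)‖ ^ 2 ∂Pr - (μ * L / 2) ^ 2 / 2 * (n * (n + 2) * (n + 4)) ≤
      ∫ ω, inner ℝ (∇ f (X ω)) (zerothGrad F μ (X ω) (ξ k ω) (u k ω)) ∂Pr := by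
  obtain ⟨hZ2, hinner, hsq⟩ := hA.memLp_and_integrals hf hpast hX hX2
  have hXm : Measurable X := hX.mono hpast le_rfl
  -- A version of the stochastic gradient that is measurable with respect to the past and ξ k, hence
  -- independent of u k.
  set Z := fun ω => limGrad F (X ω, ξ k ω) with hZ
  have hZae : (fun ω => stochGrad F (X ω) (ξ k ω)) =ᵐ[Pr] Z := by
    filter_upwards [hFξ] with ω hω using stochGrad_eq_limGrad hω.1 _
  have hZm' : Measurable[past ξ u k ⊔ MeasurableSpace.comap (ξ k) inferInstance] Z :=
    (measurable_limGrad hF).comp ((hX.mono le_sup_left le_rfl).prodMk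
      (Measurable.of_comap_le le_sup_right))
  have hZm : Measurable Z := hZm'.mono (sup_le hpast hξ.comap_le) le_rfl
  have hgm' : Measurable[past ξ u k ⊔ MeasurableSpace.comap (ξ k) inferInstance]
      (fun ω => ∇ f (X ω)) := hf.continuous_gradient.measurable.comp (hX.mono le_sup_left le_rfl)
  have hgm := hf.continuous_gradient.measurable.comp hXm
  have hind : IndepFun (fun ω => (∇ f (X ω), Z ω)) (u k) Pr := by
    rw [IndepFun_iff_Indep]
    exact indep_of_indep_of_le_left hindep.symm (hgm'.prodMk hZm').comap_le
  have hindZ : IndepFun Z (u k) Pr :=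
    hind.comp (φ := Prod.snd) (ψ := id) measurable_snd measurable_id
  have hZ2' := (memLp_congr_ae hZae).1 hZ2
  have hWZ : ∀ᵐ ω ∂Pr, ‖zerothGrad F μ (X ω) (ξ k ω) (u k ω)
      - (inner ℝ (Z ω) (u k ω) : ℝ) • u k ω‖ ≤ μ * L / 2 * ‖u k ω‖ ^ 3 := by
    filter_upwards [hFξ, hZae] with ω hω h2
    rw [← h2]
    exact norm_zerothGrad_sub_le hμ hω _ _
  obtain ⟨hW2, hWsq⟩ := secondMoment_estimator hZm hu hlaw hZ2' hindZ
    (measurable_zerothGrad hF μ hXm hξ hu).aestronglyMeasurable hWZ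
  have hcorr := inner_estimator_ge hZm hgm hu hlaw hZ2' (hf.memLp_gradient_comp hX2) hind hW2 hWZ
  have e1 : ∫ ω, ‖Z ω‖ ^ 2 ∂Pr = ∫ ω, ‖stochGrad F (X ω) (ξ k ω)‖ ^ 2 ∂Pr := by
    refine integral_congr_ae ?_
    filter_upwards [hZae] with ω hω
    rw [hω]
  have e2 : ∫ ω, inner ℝ (∇ f (X ω)) (Z ω) ∂Pr
      = ∫ ω, inner ℝ (∇ f (X ω)) (stochGrad F (X ω) (ξ k ω)) ∂Pr := by
    refine integral_congr_ae ?_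
    filter_upwards [hZae] with ω hω
    rw [hω]
  refine ⟨hW2, ?_, ?_⟩
  · rw [e1] at hWsq
    refine hWsq.trans ?_
    gcongr
  · simp only [Function.comp_apply] at hcorr
    rw [e2, hinner] at hcorr
    linarith

/-- For convex `f`, the correlation of the finite-difference estimator with the direction from a
reference point `y`. -/
theorem inner_zerothGrad_ge_of_convexOn (hf : IsC11 L f) (hc : ConvexOn ℝ Set.univ f) (hμ : 0 < μ)
    (hpast : past ξ u k ≤ mΩ) (hu : Measurable (u k))
    (hlaw : Pr.map (u k) = stdGaussian (EuclideanSpace ℝ (Fin n)))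
    (hindep : Indep (MeasurableSpace.comap (u k) inferInstance)
        (past ξ u k ⊔ MeasurableSpace.comap (ξ k) inferInstance) Pr)
    (hA1 : UnbiasedValue Pr F f ξ u k X)
    (hA2 : UnbiasedValue Pr F f ξ u k (fun ω => X ω + μ • u k ω))
    (hX : Measurable[past ξ u k] X) (hX2 : MemLp X 2 Pr)
    (hW2 : MemLp (fun ω => zerothGrad F μ (X ω) (ξ k ω) (u k ω)) 2 Pr)
    (y : EuclideanSpace ℝ (Fin n)) :
    ∫ ω, f (X ω) ∂Pr - f y - μ ^ 2 * L * n / 2 ≤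
      ∫ ω, inner ℝ (zerothGrad F μ (X ω) (ξ k ω) (u k ω)) (X ω - y) ∂Pr := by
  have hXm : Measurable X := hX.mono hpast le_rfl
  have hmle : past ξ u k ⊔ MeasurableSpace.comap (u k) inferInstance ≤ mΩ := sup_le hpast hu.comap_le
  have hcm : StronglyMeasurable[past ξ u k ⊔ MeasurableSpace.comap (u k) inferInstance]
        (fun ω => (inner ℝ (u k ω) (X ω - y) : ℝ)) := by
    have h1 : Measurable[past ξ u k ⊔ MeasurableSpace.comap (u k) inferInstance]
        X := hX.mono le_sup_left le_rfl
    have h2 : Measurable[past ξ u k ⊔ MeasurableSpace.comap (u k) inferInstance]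
        (u k) := Measurable.of_comap_le le_sup_right
    exact (h2.inner (h1.sub_const y)).stronglyMeasurable
  have hd2 : MemLp (fun ω => X ω - y) 2 Pr := hX2.sub (memLp_const y)
  set D := fun ω => F (X ω + μ • u k ω) (ξ k ω) - F (X ω) (ξ k ω) with hD
  have hDint : Integrable D Pr := hA2.1.sub hA1.1
  have hDcond : Pr[D | past ξ u k ⊔ MeasurableSpace.comap (u k) inferInstance] =ᵐ[Pr] fun ω => f (X ω + μ • u k ω) - f (X ω) := by
    filter_upwards [condExp_sub hA2.1 hA1.1
      (past ξ u k ⊔ MeasurableSpace.comap (u k) inferInstance), hA1.2, hA2.2] with ω h1 h2 h3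
    refine h1.trans ?_
    rw [Pi.sub_apply, h2, h3]
  have hWD : ∀ ω, inner ℝ (zerothGrad F μ (X ω) (ξ k ω) (u k ω)) (X ω - y)
      = μ⁻¹ * (D ω * inner ℝ (u k ω) (X ω - y)) := by
    intro ω
    rw [zerothGrad, real_inner_smul_left]
    ring
  -- D alone is only known to be integrable; the product is integrable because it is μ times the
  -- inner product of two square-integrable vectors.
  have hprod : Integrable (D * fun ω => (inner ℝ (u k ω) (X ω - y) : ℝ)) Pr := by
    refine ((hW2.integrable_inner_two hd2).const_mul μ).congr (ae_of_all _ fun ω => ?_)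
    simp only [hWD, Pi.mul_apply]
    field_simp
  have hpull := condExp_mul_of_aestronglyMeasurable_right hcm.aestronglyMeasurable hprod hDint
  -- Given the past and u k, the second factor is known, so the noisy difference is replaced by that
  -- of f with no error.
  have hlim : Pr[D * fun ω => (inner ℝ (u k ω) (X ω - y) : ℝ) | past ξ u k ⊔ MeasurableSpace.comap (u k) inferInstance] =ᵐ[Pr]
      fun ω => (f (X ω + μ • u k ω) - f (X ω)) * inner ℝ (u k ω) (X ω - y) := by
    filter_upwards [hpull, hDcond] with ω h1 h2
    rw [h1, Pi.mul_apply, h2]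
  have hint : Integrable (fun ω =>
      (f (X ω + μ • u k ω) - f (X ω)) / μ * inner ℝ (u k ω) (X ω - y)) Pr := by
    refine (((integrable_condExp
      (m := past ξ u k ⊔ MeasurableSpace.comap (u k) inferInstance)).congr hlim).const_mul μ⁻¹).congr
      (ae_of_all _ fun ω => ?_)
    simp only
    ring
  have e1 : ∫ ω, inner ℝ (zerothGrad F μ (X ω) (ξ k ω) (u k ω)) (X ω - y) ∂Pr
      = ∫ ω, (f (X ω + μ • u k ω) - f (X ω)) / μ * inner ℝ (u k ω) (X ω - y) ∂Pr := by
    simp_rw [hWD]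
    rw [integral_const_mul]
    have : ∫ ω, D ω * inner ℝ (u k ω) (X ω - y) ∂Pr
        = ∫ ω, (f (X ω + μ • u k ω) - f (X ω)) * inner ℝ (u k ω) (X ω - y) ∂Pr :=
      (integral_condExp hmle).symm.trans (integral_congr_ae hlim)
    rw [this, ← integral_const_mul]
    congr 1
    ext ω
    ring
  have hind : IndepFun X (u k) Pr := by
    rw [IndepFun_iff_Indep]
    exact indep_of_indep_of_le_left hindep.symm (hX.comap_le.trans le_sup_left)
  have hcont := hf.1.continuous
  obtain ⟨i1, e2⟩ := integral_comp_indep_stdGaussian hXm hu hlaw hind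
    (φ := fun p => (f (p.1 + μ • p.2) - f p.1) / μ * inner ℝ p.2 (p.1 - y)) (by fun_prop) hint
  rw [e1, e2]
  have hfX := hf.integrable_comp hX2
  have := integral_mono ((hfX.sub (integrable_const (f y))).sub
    (integrable_const (μ ^ 2 * L * n / 2))) i1
    (fun ω => integral_finiteDiff_mul_inner_ge hf hc hμ (X ω) y)
  refine le_trans (le_of_eq ?_) this
  rw [integral_sub' (hfX.sub (integrable_const (f y))) (integrable_const _),
    integral_sub' hfX (integrable_const (f y))]
  simp

end Method

/-! ### Evaluation at an independent random index. -/

section RandomIndex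

variable {Ω : Type*} [mΩ : MeasurableSpace Ω] {Pr : Measure Ω} [IsProbabilityMeasure Pr]

/-- The expectation of a process at an independent random index with finitely many values. -/
lemma integral_randomIndex {m : MeasurableSpace Ω} {R : Ω → ℕ}
    (hR : Measurable[mΩ] R)
    (hind : Indep (MeasurableSpace.comap R inferInstance) m Pr) (s : Finset ℕ)
    (hs : ∑ k ∈ s, Pr.real {ω | R ω = k} = 1) {φ : ℕ → Ω → ℝ}
    (hφ : ∀ k ∈ s, Measurable[m] (φ k)) (hint : ∀ k ∈ s, Integrable (φ k) Pr) :
    Integrable (fun ω => φ (R ω) ω) Pr ∧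
      ∫ ω, φ (R ω) ω ∂Pr = ∑ k ∈ s, Pr.real {ω | R ω = k} * ∫ ω, φ k ω ∂Pr := by
  have hmR : ∀ k, MeasurableSet[mΩ] {ω | R ω = k} := fun k => hR (measurableSet_singleton k)
  -- The prescribed probabilities on s already sum to one, so values of R outside s are negligible.
  have hmem : ∀ᵐ ω ∂Pr, R ω ∈ s := by
    have hU : {ω | R ω ∈ s} = ⋃ k ∈ s, {ω | R ω = k} := by ext ω; simp
    have hmU : MeasurableSet[mΩ] {ω | R ω ∈ s} := by
      rw [hU]; exact Finset.measurableSet_biUnion s fun k _ => hmR k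
    have h1 : Pr.real {ω | R ω ∈ s} = 1 := by
      rw [hU, measureReal_biUnion_finset _ fun k _ => hmR k, hs]
      intro i _ j _ hij
      exact Set.disjoint_left.2 fun ω h1 h2 => hij (h1.symm.trans h2)
    exact (mem_ae_iff_prob_eq_one hmU).2 ((ENNReal.toReal_eq_one_iff _).1 h1)
  have hind' : ∀ k ∈ s, IndepFun (fun ω => if R ω = k then (1 : ℝ) else 0) (φ k) Pr := by
    intro k hk
    have h : IndepFun R (φ k) Pr := by
      rw [IndepFun_iff_Indep]
      exact indep_of_indep_of_le_right hind (hφ k hk).comap_le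
    exact h.comp (φ := fun r => if r = k then (1 : ℝ) else 0) (ψ := id)
      (measurable_of_countable _) measurable_id
  have hone : ∀ k, (fun ω => if R ω = k then (1 : ℝ) else 0)
      = Set.indicator {ω | R ω = k} (fun _ => (1 : ℝ)) := fun k => by
    ext ω; simp [Set.indicator_apply]
  have hone_int : ∀ k, Integrable (fun ω => if R ω = k then (1 : ℝ) else 0) Pr := fun k => by
    rw [hone]; exact (integrable_const _).indicator (hmR k)
  have hprod : ∀ k ∈ s, Integrable (fun ω => (if R ω = k then (1 : ℝ) else 0) * φ k ω) Pr :=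
    fun k hk => (hind' k hk).integrable_mul (hone_int k) (hint k hk)
  have hval : ∀ k ∈ s, ∫ ω, (if R ω = k then (1 : ℝ) else 0) * φ k ω ∂Pr
      = Pr.real {ω | R ω = k} * ∫ ω, φ k ω ∂Pr := by
    intro k hk
    have := (hind' k hk).integral_fun_mul_eq_mul_integral (hone_int k).1 (hint k hk).1
    rw [this, hone, integral_indicator_const _ (hmR k)]
    simp
  have hae : (fun ω => ∑ k ∈ s, (if R ω = k then (1 : ℝ) else 0) * φ k ω)
      =ᵐ[Pr] fun ω => φ (R ω) ω := by
    filter_upwards [hmem] with ω hω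
    simp [ite_mul, hω]
  refine ⟨(integrable_finsetSum s hprod).congr hae, ?_⟩
  rw [← integral_congr_ae hae, integral_finsetSum s hprod]
  exact Finset.sum_congr rfl hval

end RandomIndex

lemma sum_Icc_le_sub_of_le {a p : ℕ → ℝ} {N : ℕ}
    (h : ∀ k ∈ Finset.Icc 1 N, p k ≤ a k - a (k + 1)) :
    ∑ k ∈ Finset.Icc 1 N, p k ≤ a 1 - a (N + 1) := by
  induction N with
  | zero => simp
  | succ N ih =>
    rw [Finset.sum_Icc_succ_top (by omega)]
    have h1 := ih fun k hk => h k (by rw [Finset.mem_Icc] at hk ⊢; omega)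
    have h2 := h (N + 1) (by simp)
    linarith

/-! ### Expected change of the objective and of the squared distance in one step. -/

section Descent

variable {n : ℕ} {Ω : Type*} [MeasurableSpace Ω] {Pr : Measure Ω} [IsProbabilityMeasure Pr]
  {X W : Ω → EuclideanSpace ℝ (Fin n)}

lemma IsC11.integral_descent {L : ℝ} {f : EuclideanSpace ℝ (Fin n) → ℝ} (hf : IsC11 L f)
    (hX : MemLp X 2 Pr) (hW : MemLp W 2 Pr) (γ : ℝ) :
    ∫ ω, f (X ω - γ • W ω) ∂Pr ≤ ∫ ω, f (X ω) ∂Pr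
      - γ * ∫ ω, inner ℝ (∇ f (X ω)) (W ω) ∂Pr + L / 2 * γ ^ 2 * ∫ ω, ‖W ω‖ ^ 2 ∂Pr := by
  have i0 : Integrable (fun ω => f (X ω - γ • W ω)) Pr :=
    hf.integrable_comp (hX.sub (hW.const_smul γ))
  have i1 := hf.integrable_comp hX
  have i2 := ((hf.memLp_gradient_comp hX).integrable_inner_two hW).const_mul γ
  have i3 := hW.integrable_norm_sq.const_mul (L / 2 * γ ^ 2)
  have h := integral_mono i0 ((i1.sub i2).add i3) fun ω => by
    have := hf.le_quadratic (X ω) (X ω - γ • W ω)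
    rw [sub_sub_cancel_left, norm_neg, inner_neg_right, inner_smul_right, norm_smul, mul_pow,
      Real.norm_eq_abs, sq_abs] at this
    simp only [Pi.add_apply, Pi.sub_apply]
    linarith
  rwa [integral_add' (i1.sub i2) i3, integral_sub' i1 i2, integral_const_mul,
    integral_const_mul] at h

lemma integral_norm_sub_smul_sq (hX : MemLp X 2 Pr) (hW : MemLp W 2 Pr) (γ : ℝ)
    (y : EuclideanSpace ℝ (Fin n)) :
    ∫ ω, ‖X ω - γ • W ω - y‖ ^ 2 ∂Pr = ∫ ω, ‖X ω - y‖ ^ 2 ∂Pr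
      - 2 * γ * ∫ ω, inner ℝ (W ω) (X ω - y) ∂Pr + γ ^ 2 * ∫ ω, ‖W ω‖ ^ 2 ∂Pr := by
  have hd : MemLp (fun ω => X ω - y) 2 Pr := hX.sub (memLp_const y)
  have i1 := hd.integrable_norm_sq
  have i2 := (hW.integrable_inner_two hd).const_mul (2 * γ)
  have i3 := hW.integrable_norm_sq.const_mul (γ ^ 2)
  rw [← integral_const_mul, ← integral_const_mul, ← integral_sub' i1 i2,
    ← integral_add' (i1.sub i2) i3]
  refine integral_congr_ae (ae_of_all _ fun ω => ?_)
  simp only [Pi.add_apply, Pi.sub_apply]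
  rw [sub_right_comm, norm_sub_sq_real, inner_smul_right, norm_smul, mul_pow, Real.norm_eq_abs,
    sq_abs, real_inner_comm]
  ring

end Descent

/-! ### Scalar inequalities for one step. -/

lemma nat_mul_le_add_four_cube (n : ℕ) :
    ((n : ℝ) * (n + 2) * (n + 4)) ≤ (n + 4) ^ 3 := by
  have h : (0 : ℝ) ≤ n := Nat.cast_nonneg n
  have h2 : (n : ℝ) * (n + 2) ≤ (n + 4) ^ 2 := by nlinarith
  calc (n : ℝ) * (n + 2) * (n + 4) ≤ (n + 4) ^ 2 * (n + 4) := by gcongr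
    _ = _ := by ring

lemma weight_pos {n : ℕ} {L : ℝ} (hL : 0 < L) {γ : ℕ → ℝ} {k : ℕ}
    (h : 0 < γ k ∧ γ k < 1 / (2 * (n + 4) * L)) : 0 < weight n L γ k := by
  have h1 : γ k * (2 * (n + 4) * L) < 1 := (lt_div_iff₀ (by positivity)).1 h.2
  have : weight n L γ k = γ k * (1 - γ k * (2 * (n + 4) * L)) := by unfold weight; ring
  rw [this]
  exact mul_pos h.1 (by linarith)

/-- The arithmetic of one step for smooth objectives. -/
lemma smooth_step_arith {n : ℕ} {L μ γ σ a a' b C S : ℝ} (hL : 0 < L) (hγ : 0 < γ) (hb : 0 ≤ b)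
    (hS : S ≤ 2 * (n + 2) * (b + σ ^ 2) + 2 * (μ * L / 2) ^ 2 * (n * (n + 2) * (n + 4)))
    (hC : 1 / 2 * b - (μ * L / 2) ^ 2 / 2 * (n * (n + 2) * (n + 4)) ≤ C)
    (h : a' ≤ a - γ * C + L / 2 * γ ^ 2 * S) :
    (γ - 2 * L * (n + 4) * γ ^ 2) * b
      - (2 * μ ^ 2 * (n + 4) * (L * (n + 4) ^ 2) * L * (γ / 4 + L * γ ^ 2)
        + 2 * (n + 4) * σ ^ 2 * L * γ ^ 2) ≤ 2 * a - 2 * a' := by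
  have hM := nat_mul_le_add_four_cube n
  set M : ℝ := n * (n + 2) * (n + 4) with hMdef
  have h1 : γ * (1 / 2 * b - (μ * L / 2) ^ 2 / 2 * M) ≤ γ * C := by gcongr
  have h2 : L / 2 * γ ^ 2 * S ≤ L / 2 * γ ^ 2 * (2 * (n + 2) * (b + σ ^ 2)
    + 2 * (μ * L / 2) ^ 2 * M) := by gcongr
  have h3 : μ ^ 2 * L ^ 2 * γ * M ≤ μ ^ 2 * L ^ 2 * γ * (n + 4) ^ 3 := by gcongr
  have h4 : μ ^ 2 * L ^ 3 * γ ^ 2 * M ≤ μ ^ 2 * L ^ 3 * γ ^ 2 * (n + 4) ^ 3 := by gcongr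
  have p1 : 0 ≤ L * γ ^ 2 * b := by positivity
  have p2 : 0 ≤ L * γ ^ 2 * σ ^ 2 := by positivity
  have p3 : 0 ≤ μ ^ 2 * L ^ 2 * γ * (n + 4) ^ 3 := by positivity
  have p4 : 0 ≤ μ ^ 2 * L ^ 3 * γ ^ 2 * (n + 4) ^ 3 := by positivity
  -- After doubling, b has coefficient γ - 2L(n+2)γ², at least the weight. The smoothing errors
  -- μ²L²γM/4 and μ²L³γ²M/2 fit below the allowed terms with M replaced by (n+4)³.
  nlinarith

/-- The arithmetic of one step for convex objectives. -/
lemma convex_step_arith {n : ℕ} {L μ γ σ D D' δ b C S : ℝ} (hL : 0 < L) (hγ : 0 < γ)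
    (hδ : 0 ≤ δ) (hbδ : b ≤ 2 * L * δ)
    (hS : S ≤ 2 * (n + 2) * (b + σ ^ 2) + 2 * (μ * L / 2) ^ 2 * (n * (n + 2) * (n + 4)))
    (hC : δ - μ ^ 2 * L * n / 2 ≤ C)
    (h : D' = D - 2 * γ * C + γ ^ 2 * S) :
    2 * (γ - 2 * (n + 4) * L * γ ^ 2) * δ
      - (2 * μ ^ 2 * L * (n + 4) * (γ + L * (n + 4) ^ 2 * γ ^ 2)
        + 2 * (n + 4) * σ ^ 2 * γ ^ 2) ≤ D - D' := by
  have hM := nat_mul_le_add_four_cube n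
  set M : ℝ := n * (n + 2) * (n + 4) with hMdef
  have h1 : 2 * γ * (δ - μ ^ 2 * L * n / 2) ≤ 2 * γ * C := by gcongr
  -- The gradient moment b is traded for 2Lδ, at a cost of 4(n+2)Lγ²δ that the weight accounts for.
  have h2 : γ ^ 2 * S ≤ γ ^ 2 * (2 * (n + 2) * (2 * L * δ + σ ^ 2)
    + 2 * (μ * L / 2) ^ 2 * M) := by
    gcongr
    refine hS.trans ?_
    gcongr
  have h4 : μ ^ 2 * L ^ 2 * γ ^ 2 * M ≤ μ ^ 2 * L ^ 2 * γ ^ 2 * (n + 4) ^ 3 := by gcongr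
  have p1 : 0 ≤ L * γ ^ 2 * δ := by positivity
  have p2 : 0 ≤ γ ^ 2 * σ ^ 2 := by positivity
  have p3 : 0 ≤ μ ^ 2 * L * γ * n := by positivity
  have p5 : 0 ≤ μ ^ 2 * L * γ := by positivity
  have p4 : 0 ≤ μ ^ 2 * L ^ 2 * γ ^ 2 * (n + 4) ^ 3 := by positivity
  nlinarith

/-! ### Summation over the steps and the two complexity bounds. -/

theorem mainTheorem5
    {n : ℕ} {Ξ Ω : Type*} [MeasurableSpace Ξ] [MeasurableSpace Ω]
    -- the problem: `f(x) = ∫ F(x, s) dP(s)`, bounded below, with `F(·, s)` almost surely `C^{1,1}_L`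
    (P : Measure Ξ) [IsProbabilityMeasure P]
    (F : EuclideanSpace ℝ (Fin n) → Ξ → ℝ) (hF : Measurable (Function.uncurry F))
    (hFint : ∀ x, Integrable (F x) P)
    (L : ℝ) (hL : 0 < L) (hFP : ∀ᵐ s ∂P, IsC11 L (fun x => F x s))
    (f : EuclideanSpace ℝ (Fin n) → ℝ) (hf : f = objective F P)
    (hbdd : BddBelow (Set.range f))
    -- the input of the method
    (x₁ : EuclideanSpace ℝ (Fin n)) (N : ℕ) (hN : 1 ≤ N) (μ : ℝ) (hμ : 0 < μ) (γ : ℕ → ℝ)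
    (hγ : ∀ k ∈ Finset.Icc 1 N, 0 < γ k ∧ γ k < 1 / (2 * (n + 4) * L))
    -- the random variables of the method
    (Pr : Measure Ω) [IsProbabilityMeasure Pr]
    (ξ : ℕ → Ω → Ξ) (u : ℕ → Ω → EuclideanSpace ℝ (Fin n)) (R : Ω → ℕ)
    (hξ : ∀ k ∈ Finset.Icc 1 N, Measurable (ξ k))
    (hFξ : ∀ k ∈ Finset.Icc 1 N, ∀ᵐ ω ∂Pr, IsC11 L (fun x => F x (ξ k ω)))
    (hu : ∀ k ∈ Finset.Icc 1 N, Measurable (u k))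
    (hu_law : ∀ k ∈ Finset.Icc 1 N,
      Pr.map (u k) = stdGaussian (EuclideanSpace ℝ (Fin n)))
    (hu_indep : ∀ k ∈ Finset.Icc 1 N,
      Indep (MeasurableSpace.comap (u k) inferInstance)
        (past ξ u k ⊔ MeasurableSpace.comap (ξ k) inferInstance) Pr)
    (hR : Measurable R)
    (hR_law : ∀ k ∈ Finset.Icc 1 N,
      Pr.real {ω | R ω = k} = weight n L γ k / ∑ j ∈ Finset.Icc 1 N, weight n L γ j)
    (hR_indep : Indep (MeasurableSpace.comap R inferInstance) (past ξ u (N + 1)) Pr)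
    -- the search points
    (x : ℕ → Ω → EuclideanSpace ℝ (Fin n)) (hx : x = searchPoint F μ γ x₁ ξ u)
    -- the oracle assumptions
    (σ : ℝ) (hσ : 0 ≤ σ)
    (hA1 : ∀ k ∈ Finset.Icc 1 N, UnbiasedGradient Pr F f σ ξ u k (x k))
    (hA3 : ∀ k ∈ Finset.Icc 1 N, UnbiasedValue Pr F f ξ u k (x k) ∧
      UnbiasedValue Pr F f ξ u k (fun ω => x k ω + μ • u k ω))
    -- the optimal value and the initial gap
    (fstar : ℝ) (hfstar : fstar = ⨅ y, f y)
    (Df : ℝ) (hDf : Df = Real.sqrt (2 * (f x₁ - fstar) / L)) :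
    (Integrable (fun ω => ‖∇ f (x (R ω) ω)‖ ^ 2) Pr ∧
      (1 / L) * ∫ ω, ‖∇ f (x (R ω) ω)‖ ^ 2 ∂Pr ≤
        1 / (∑ k ∈ Finset.Icc 1 N, (γ k - 2 * L * (n + 4) * γ k ^ 2)) *
          (Df ^ 2
            + 2 * μ ^ 2 * (n + 4) *
                (1 + L * (n + 4) ^ 2 * ∑ k ∈ Finset.Icc 1 N, (γ k / 4 + L * γ k ^ 2))
            + 2 * (n + 4) * σ ^ 2 * ∑ k ∈ Finset.Icc 1 N, γ k ^ 2)) ∧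
    (ConvexOn ℝ Set.univ f → ∀ xstar : EuclideanSpace ℝ (Fin n), (∀ y, f xstar ≤ f y) →
      Integrable (fun ω => f (x (R ω) ω) - fstar) Pr ∧
        ∫ ω, (f (x (R ω) ω) - fstar) ∂Pr ≤
          1 / (2 * ∑ k ∈ Finset.Icc 1 N, (γ k - 2 * (n + 4) * L * γ k ^ 2)) *
            (‖x₁ - xstar‖ ^ 2
              + 2 * μ ^ 2 * L * (n + 4) *
                  ∑ k ∈ Finset.Icc 1 N, (γ k + L * (n + 4) ^ 2 * γ k ^ 2)
              + 2 * (n + 4) * σ ^ 2 * ∑ k ∈ Finset.Icc 1 N, γ k ^ 2)) := by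
  have hC : IsC11 L f := hf ▸ isC11_objective hF hFint hFP
  have hfle : ∀ y, fstar ≤ f y := fun y => hfstar ▸ ciInf_le hbdd y
  have hpast : ∀ k ≤ N + 1, past ξ u k ≤ ‹MeasurableSpace Ω› := fun k hk => past_le hξ hu hk
  have hxm : ∀ k, Measurable[past ξ u k] (x k) := fun k =>
    hx ▸ measurable_searchPoint hF μ γ x₁ k
  have hx1 : x 1 = fun _ => x₁ := by
    rw [hx]; exact funext fun _ => by rw [searchPoint]
  have hxsucc : ∀ k, 1 ≤ k → ∀ ω, x (k + 1) ω =
      x k ω - γ k • zerothGrad F μ (x k ω) (ξ k ω) (u k ω) := by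
    rintro (_ | k) hk
    · omega
    · rw [hx]; exact fun _ => by rw [searchPoint]
  have hmom := fun k (hk : k ∈ Finset.Icc 1 N) (hk2 : MemLp (x k) 2 Pr) =>
    zerothGrad_moments hF hC hμ (hpast k ((Finset.mem_Icc.1 hk).2.trans (Nat.le_succ N)))
      (hξ k hk) (hFξ k hk) (hu k hk) (hu_law k hk) (hu_indep k hk) (hA1 k hk) (hxm k) hk2
  -- Square integrability is not assumed: it propagates by induction, since a square-integrable
  -- point yields a square-integrable estimator. The last point, of index N + 1, is included because
  -- the telescoped sums end there.
  have hxL : ∀ k, k + 1 ≤ N + 1 → MemLp (x (k + 1)) 2 Pr := by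
    intro k
    induction k with
    | zero => intro _; rw [zero_add, hx1]; exact memLp_const _
    | succ k ih =>
      intro hk
      have hkm : k + 1 ∈ Finset.Icc 1 N := Finset.mem_Icc.2 ⟨by omega, by omega⟩
      rw [funext (hxsucc (k + 1) (by omega))]
      exact (ih (by omega)).sub ((hmom _ hkm (ih (by omega))).1.const_smul (γ (k + 1)))
  have hxLk : ∀ k ∈ Finset.Icc 1 N, MemLp (x k) 2 Pr := by
    intro k hk
    obtain ⟨h1, h2⟩ := Finset.mem_Icc.1 hk
    obtain ⟨j, rfl⟩ := Nat.exists_eq_add_of_le' h1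
    exact hxL j (by omega)
  have hw : ∀ k ∈ Finset.Icc 1 N, 0 < weight n L γ k := fun k hk => weight_pos hL (hγ k hk)
  have hWpos : 0 < ∑ k ∈ Finset.Icc 1 N, weight n L γ k :=
    Finset.sum_pos hw ⟨1, Finset.mem_Icc.2 ⟨le_rfl, hN⟩⟩
  have hRsum : ∑ k ∈ Finset.Icc 1 N, Pr.real {ω | R ω = k} = 1 := by
    rw [Finset.sum_congr rfl hR_law, ← Finset.sum_div, div_self hWpos.ne']
  have hxmN : ∀ k ∈ Finset.Icc 1 N, Measurable[past ξ u (N + 1)] (x k) := fun k hk =>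
    (hxm k).mono (past_mono ((Finset.mem_Icc.1 hk).2.trans (Nat.le_succ N))) le_rfl
  have hrandom : ∀ φ : EuclideanSpace ℝ (Fin n) → ℝ, Continuous φ →
      (∀ k ∈ Finset.Icc 1 N, Integrable (fun ω => φ (x k ω)) Pr) →
      Integrable (fun ω => φ (x (R ω) ω)) Pr ∧ ∫ ω, φ (x (R ω) ω) ∂Pr =
        (1 / ∑ k ∈ Finset.Icc 1 N, weight n L γ k)
          * ∑ k ∈ Finset.Icc 1 N, weight n L γ k * ∫ ω, φ (x k ω) ∂Pr := by
    intro φ hφ hint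
    obtain ⟨h1, h2⟩ := integral_randomIndex hR hR_indep (Finset.Icc 1 N) hRsum
      (φ := fun k ω => φ (x k ω)) (fun k hk => hφ.measurable.comp (hxmN k hk)) hint
    refine ⟨h1, h2.trans ?_⟩
    rw [Finset.mul_sum]
    refine Finset.sum_congr rfl fun k hk => ?_
    rw [hR_law k hk]
    ring
  have hgcont := hC.continuous_gradient
  refine ⟨?_, fun hconv xstar hmin => ?_⟩
  · obtain ⟨h1, h2⟩ := hrandom (fun y => ‖∇ f y‖ ^ 2) (by fun_prop)
      fun k hk => (hC.memLp_gradient_comp (hxLk k hk)).integrable_norm_sq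
    refine ⟨h1, ?_⟩
    -- The two sides are fixed by unification with `smooth_step_arith`; the right side telescopes in
    -- 2 E f(x_k).
    have hstep : ∀ k ∈ Finset.Icc 1 N, _ ≤ _ := fun k hk => by
      obtain ⟨hW2, hS, hCor⟩ := hmom k hk (hxLk k hk)
      have hd := hC.integral_descent (hxLk k hk) hW2 (γ k)
      simp_rw [← hxsucc k (Finset.mem_Icc.1 hk).1] at hd
      exact smooth_step_arith hL (hγ k hk).1 (integral_nonneg fun ω => by positivity) hS hCor hd
    have hsum := sum_Icc_le_sub_of_le (a := fun k => 2 * ∫ ω, f (x k ω) ∂Pr) hstep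
    have hlast : fstar ≤ ∫ ω, f (x (N + 1) ω) ∂Pr := by
      have := integral_mono (integrable_const fstar)
        (hC.integrable_comp (hxL N le_rfl)) fun ω => hfle (x (N + 1) ω)
      simpa using this
    have hfirst : ∫ ω, f (x 1 ω) ∂Pr = f x₁ := by rw [hx1]; simp
    have hDf2 : L * Df ^ 2 = 2 * (f x₁ - fstar) := by
      rw [hDf, Real.sq_sqrt]
      · field_simp
      · have := hfle x₁
        exact div_nonneg (by linarith) hL.le
    rw [Finset.sum_sub_distrib, Finset.sum_add_distrib, ← Finset.mul_sum, ← Finset.mul_sum,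
      hfirst] at hsum
    rw [h2]
    change 1 / L * ((1 / ∑ k ∈ Finset.Icc 1 N, weight n L γ k) * _) ≤
      (1 / ∑ k ∈ Finset.Icc 1 N, weight n L γ k) * _
    rw [mul_left_comm]
    refine mul_le_mul_of_nonneg_left ?_ (by positivity)
    rw [one_div, inv_mul_le_iff₀ hL]
    -- The summand 1 in the stated bound is pure slack here, since descent is measured in f itself.
    have hpos : 0 ≤ L * (2 * μ ^ 2 * (n + 4)) := by positivity
    unfold weight
    linarith
  · have hfs : f xstar = fstar :=
      le_antisymm (hfstar ▸ le_ciInf hmin) (hfle xstar)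
    obtain ⟨h1, h2⟩ := hrandom (fun y => f y - fstar) (by have := hC.1.continuous; fun_prop)
      fun k hk => (hC.integrable_comp (hxLk k hk)).sub (integrable_const _)
    refine ⟨h1, ?_⟩
    have hstep : ∀ k ∈ Finset.Icc 1 N, _ ≤ _ := fun k hk => by
      obtain ⟨hW2, hS, -⟩ := hmom k hk (hxLk k hk)
      have hCor := inner_zerothGrad_ge_of_convexOn hC hconv hμ
        (hpast k ((Finset.mem_Icc.1 hk).2.trans (Nat.le_succ N))) (hu k hk) (hu_law k hk)
        (hu_indep k hk) (hA3 k hk).1 (hA3 k hk).2 (hxm k) (hxLk k hk) hW2 xstar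
      have hd := integral_norm_sub_smul_sq (hxLk k hk) hW2 (γ k) xstar
      simp_rw [← hxsucc k (Finset.mem_Icc.1 hk).1] at hd
      have hfi := hC.integrable_comp (hxLk k hk)
      have hδ : ∫ ω, f (x k ω) ∂Pr - f xstar = ∫ ω, (f (x k ω) - fstar) ∂Pr := by
        rw [integral_sub hfi (integrable_const _), hfs]; simp
      -- Expresses the second moment of the estimator through the optimality gap, the quantity being
      -- summed.
      have hb : ∫ ω, ‖∇ f (x k ω)‖ ^ 2 ∂Pr ≤ 2 * L * ∫ ω, (f (x k ω) - fstar) ∂Pr := by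
        rw [← integral_const_mul]
        exact integral_mono (hC.memLp_gradient_comp (hxLk k hk)).integrable_norm_sq
          ((hfi.sub (integrable_const _)).const_mul _)
          fun ω => hC.norm_gradient_sq_le hL hfle (x k ω)
      rw [hδ] at hCor
      exact convex_step_arith hL (hγ k hk).1
        (integral_nonneg fun ω => sub_nonneg.2 (hfle _)) hb hS hCor hd
    have hsum := sum_Icc_le_sub_of_le (a := fun k => ∫ ω, ‖x k ω - xstar‖ ^ 2 ∂Pr) hstep
    have hlast : 0 ≤ ∫ ω, ‖x (N + 1) ω - xstar‖ ^ 2 ∂Pr := integral_nonneg fun ω => by positivity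
    have hfirst : ∫ ω, ‖x 1 ω - xstar‖ ^ 2 ∂Pr = ‖x₁ - xstar‖ ^ 2 := by rw [hx1]; simp
    rw [Finset.sum_sub_distrib, Finset.sum_add_distrib, ← Finset.mul_sum, ← Finset.mul_sum,
      hfirst] at hsum
    have hweq : ∀ k, γ k - 2 * (n + 4) * L * γ k ^ 2 = weight n L γ k := fun k => by
      unfold weight; ring
    simp_rw [hweq] at hsum ⊢
    have hdouble : ∑ k ∈ Finset.Icc 1 N, 2 * weight n L γ k * ∫ ω, (f (x k ω) - fstar) ∂Pr
        = 2 * ∑ k ∈ Finset.Icc 1 N, weight n L γ k * ∫ ω, (f (x k ω) - fstar) ∂Pr := by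
      rw [Finset.mul_sum]
      exact Finset.sum_congr rfl fun k _ => mul_assoc _ _ _
    rw [h2, one_div, one_div, mul_inv, mul_comm (2⁻¹ : ℝ), mul_assoc]
    refine mul_le_mul_of_nonneg_left ?_ (by positivity)
    linarith
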